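/- **Setting.** Let $\Sigma$ be a signature, $\mathcal V$ a set of variables, $\mathcal T$ the set of terms over $\Sigma$ and $\mathcal V$, and $\mathcal D\subseteq\Sigma$ a set of *defined* symbols. For every $f\in\mathcal D$ let $f^\#$ be a fresh annotated symbol of the same arity, $\mathcal D^\#=\{f^\#\mid f\in\mathcal D\}$, $\Sigma^\#=\mathcal D^\#\uplus\Sigma$, and let $\mathcal T^\#$ be the set of terms over $\Sigma^\#$ and $\mathcal V$. For $t\in\mathcal T^\#$ let $\mathrm{Pos}_{\mathcal D^\#}(t)$, $\mathrm{Pos}_{\mathcal V}(t)$ be its positions of annotated symbols and of variables, and let $\flat(t)\in\mathcal T$ be $t$ with all annotations removed. For a set $\Phi$ of positions of symbols from $\mathcal D\cup\mathcal D^\#$ in $t$, $\#_\Phi(t)$ is $t$ with exactly the symbols at positions in $\Phi$ annotated, and $\flat^\uparrow_\pi(t)$ is $t$ with all annotations strictly above $\pi$ removed. For $t=f(t_1,\dots,t_n)\in\mathcal T$ with $f\in\mathcal D$ let $t^\#=f^\#(t_1,\dots,t_n)$. An *annotated dependency pair (ADP)* $\ell\to\{p_1:r_1,\dots,p_k:r_k\}^m$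 consists of a term $\ell\in\mathcal T$ with root symbol in $\mathcal D$, a flag $m\in\{\mathsf{true},\mathsf{false}\}$, and a finite multiset of pairs with $0<p_j\le1$, $\sum_jp_j=1$, $r_j\in\mathcal T^\#$ and $\mathcal V(r_j)\subseteq\mathcal V(\ell)$. An *ADP problem* is a finite set $\mathcal P$ of ADPs. Write $\flat(\ell\to\{p_j:r_j\}^m)=\ell\to\{p_j:\flat(r_j)\}^m$ and $\flat(\mathcal Q)=\{\flat(\alpha)\mid\alpha\in\mathcal Q\}$. *Innermost rewriting.* $s\in\mathcal T^\#$ rewrites innermost with $\mathcal P$ to $\{p_1:t_1,\dots,p_k:t_k\}$ if there are $\ell\to\{p_1:r_1,\dots,p_k:r_k\}^m\in\mathcal P$, a substitution $\sigma:\mathcal V\to\mathcal T$ and a position $\pi$ of $s$ with $\flat(s|_\pi)=\ell\sigma$ such that no proper subterm of $\ell\sigma$ is an instance of a left-hand side of $\mathcal P$, and for all $j$: (at) $t_j=s[r_j\sigma]_\pi$ if $\pi\in\mathrm{Pos}_{\mathcal D^\#}(s)$ and $m=\mathsf{true}$; (af) $t_j=\flat^\uparrow_\pi(s[r_j\sigma]_\pi)$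 if $\pi\in\mathrm{Pos}_{\mathcal D^\#}(s)$ and $m=\mathsf{false}$; (nt) $t_j=s[\flat(r_j)\sigma]_\pi$ if $\pi\notin\mathrm{Pos}_{\mathcal D^\#}(s)$ and $m=\mathsf{true}$; (nf) $t_j=\flat^\uparrow_\pi(s[\flat(r_j)\sigma]_\pi)$ if $\pi\notin\mathrm{Pos}_{\mathcal D^\#}(s)$ and $m=\mathsf{false}$. *Full rewriting.* $s\in\mathcal T^\#$ rewrites with $\mathcal P$ to $\{p_1:t_1,\dots,p_k:t_k\}$ if there are an ADP in $\mathcal P$, $\sigma$ and $\pi$ as above with $\flat(s|_\pi)=\ell\sigma$ (without the requirement on proper subterms), and functions $\varphi_j:\mathrm{Pos}_{\mathcal V}(\ell)\to\mathrm{Pos}_{\mathcal V}(r_j)\uplus\{\bot\}$ with $\ell|_\rho=r_j|_{\varphi_j(\rho)}$ whenever $\varphi_j(\rho)\ne\bot$, such that, with $\Psi_j=\{\varphi_j(\rho).\tau\mid\rho\in\mathrm{Pos}_{\mathcal V}(\ell),\varphi_j(\rho)\neq\bot,\rho.\tau\in\mathrm{Pos}_{\mathcal D^\#}(s|_\pi)\}$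 and $\Phi_j=\mathrm{Pos}_{\mathcal D^\#}(r_j)\cup\Psi_j$, for all $j$: (at) $t_j=s[\#_{\Phi_j}(r_j\sigma)]_\pi$ if $\pi\in\mathrm{Pos}_{\mathcal D^\#}(s)$ and $m=\mathsf{true}$; (af) $t_j=\flat^\uparrow_\pi(s[\#_{\Phi_j}(r_j\sigma)]_\pi)$ if $\pi\in\mathrm{Pos}_{\mathcal D^\#}(s)$ and $m=\mathsf{false}$; (nt) $t_j=s[\#_{\Psi_j}(r_j\sigma)]_\pi$ if $\pi\notin\mathrm{Pos}_{\mathcal D^\#}(s)$ and $m=\mathsf{true}$ (no step if $\pi\notin\mathrm{Pos}_{\mathcal D^\#}(s)$ and $m=\mathsf{false}$). A *$\mathcal P$-chain tree* (resp. *innermost $\mathcal P$-chain tree*) is a finitely branching rooted directed tree whose nodes $v$ are labelled by a probability $p_v\in(0,1]$ and a term $t_v\in\mathcal T^\#$, with a set $A$ of inner nodes, such that $p_v=1$ at the root; for every inner node $v$ with successors $w_1,\dots,w_k$, $t_v$ rewrites (resp. rewrites innermost) with $\mathcal P$ to $\{\frac{p_{w_1}}{p_v}:t_{w_1},\dots,\frac{p_{w_k}}{p_v}:t_{w_k}\}$,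 using (at) or (af) if $v\in A$ and (nt) or (nf) if $v\notin A$; and every infinite path contains infinitely many nodes of $A$. $\mathcal P$ is $\mathtt{AST}$ (resp. $\mathtt{iAST}$) if the sum of the $p_v$ over all leaves $v$ is $1$ for every (resp. every innermost) $\mathcal P$-chain tree. A *multilinear polynomial interpretation* $\mathrm{Pol}$ maps every $n$-ary $f\in\Sigma^\#$ to a polynomial $f_{\mathrm{Pol}}$ in $n$ variables with coefficients in $\mathbb N$ in which every variable has exponent at most $1$ in every monomial; it extends to $\mathrm{Pol}:\mathcal T^\#\to\mathbb N[\mathcal V]$ homomorphically. Inequalities between polynomials are required for all instantiations of the variables by natural numbers. The *$\#$-sum* is $\mathcal Sum(r)=\sum_{\pi\in\mathrm{Pos}_{\mathcal D^\#}(r)}\mathrm{Pol}(\flat(r|_\pi)^\#)$. **Theorem (Reduction Pair Processor for $\mathtt{iAST}$ and $\mathtt{AST}$).** Let $\mathrm{Pol}$ be a multilinear polynomial interpretation, and let $\mathcal P=\mathcal P_\ge\uplus\mathcal P_>$ be an ADP problem with $\mathcal P_>\ne\emptyset$ such that: 1. for every $\ell\to\{p_1:r_1,\dots,p_k:r_k\}^m\in\mathcal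 P$: $\mathrm{Pol}(\ell^\#)\ge\sum_{1\le j\le k}p_j\cdot\mathcal Sum(r_j)$; 2. for every $\ell\to\{p_1:r_1,\dots,p_k:r_k\}^m\in\mathcal P_>$ there is $j\in\{1,\dots,k\}$ with $\mathrm{Pol}(\ell^\#)>\mathcal Sum(r_j)$ and, if $m=\mathsf{true}$, additionally $\mathrm{Pol}(\ell)\ge\mathrm{Pol}(\flat(r_j))$; 3. for every $\ell\to\{p_1:r_1,\dots,p_k:r_k\}^{\mathsf{true}}\in\mathcal P$: $\mathrm{Pol}(\ell)\ge\sum_{1\le j\le k}p_j\cdot\mathrm{Pol}(\flat(r_j))$. Then replacing $\mathcal P$ by $\mathcal P_\ge\cup\flat(\mathcal P_>)$ is sound and complete for $\mathtt{iAST}$ and for $\mathtt{AST}$: if $\mathcal P_\ge\cup\flat(\mathcal P_>)$ is $\mathtt{iAST}$ (resp. $\mathtt{AST}$) then so is $\mathcal P$, and conversely. -/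

import Mathlib

universe u w v

noncomputable section

namespace ADPFramework

/-! ### Terms and annotated terms

A signature is the family of function symbols of a first-order language `L` (its relation symbols
play no role), `D n` is the set of defined symbols of arity `n`, and terms are Mathlib's terms. -/

/-- The annotated signature `Σ^# = D^# ⊎ Σ`: `Sum.inl f` is the annotated symbol `f^#` of the
defined symbol `f`, and `Sum.inr f` is the symbol `f` itself. -/
def annot (L : FirstOrder.Language.{u, w}) (D : ∀ n, Set (L.Functions n)) : FirstOrder.Language.{u, w} where
  Functions n := D n ⊕ L.Functions n
  Relations := L.Relations

/-- The terms `T` over the signature `Σ` with variables from `V`. -/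
abbrev Trm (L : FirstOrder.Language.{u, w}) (V : Type v) := L.Term V

/-- The annotated terms `T^#` over `Σ^#` with variables from `V`. -/
abbrev ATrm (L : FirstOrder.Language.{u, w}) (D : ∀ n, Set (L.Functions n)) (V : Type v) :=
  (annot L D).Term V

/-- Positions of terms (argument positions are counted from `0`). -/
abbrev Position := List ℕ

/-- The subterm `t|_π`; the value is `none` iff `π` is not a position of `t`. -/
def subtermAt {L : FirstOrder.Language.{u, w}} {V : Type v} : L.Term V → Position → Option (L.Term V)
  | t, [] => some t
  | .var _, _ :: _ => none
  | @FirstOrder.Language.Term.func _ _ n _ ts, i :: π => if h : i < n then subtermAt (ts ⟨i, h⟩) π else none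

/-- The term `t[r]_π` (used only for positions `π` of `t`). -/
def replaceAt {L : FirstOrder.Language.{u, w}} {V : Type v} : L.Term V → Position → L.Term V → L.Term V
  | _, [], r => r
  | .var x, _ :: _, _ => .var x
  | .func f ts, i :: π, r =>
      .func f (fun j => if (j : ℕ) = i then replaceAt (ts j) π r else ts j)

/-- The variables `V(t)` occurring in a term. -/
def vars {L : FirstOrder.Language.{u, w}} {V : Type v} (t : L.Term V) : Set V :=
  {x | ∃ ρ, subtermAt t ρ = some (.var x)}

variable {L : FirstOrder.Language.{u, w}} {D : ∀ n, Set (L.Functions n)} {V : Type v}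

/-- The symbol of `Σ` underlying a symbol of `Σ^#`. -/
def baseSym {n : ℕ} : (annot L D).Functions n → L.Functions n
  | Sum.inl f => f.1
  | Sum.inr f => f

/-- The inclusion `T ⊆ T^#`. -/
def emb : Trm L V → ATrm L D V
  | .var x => .var x
  | .func f ts => .func (Sum.inr f : (annot L D).Functions _) (fun i => emb (ts i))

/-- `♭(t)`, as a term of `T`: all annotations are removed. -/
def flat : ATrm L D V → Trm L V
  | .var x => .var x
  | .func f ts => .func (baseSym f) (fun i => flat (ts i))

open Classical in
/-- `f^#` for a symbol `f` whose underlying symbol is defined (other symbols stay unchanged). -/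
def annSym {n : ℕ} (f : (annot L D).Functions n) : (annot L D).Functions n :=
  if h : baseSym f ∈ D n then Sum.inl ⟨baseSym f, h⟩ else f

open Classical in
/-- `#_Φ(t)`: exactly the symbols at the positions from `Φ` (which have to be positions of symbols
from `D ∪ D^#`) are annotated. -/
def anno : Set Position → ATrm L D V → ATrm L D V
  | _, .var x => .var x
  | Φ, .func f ts =>
      .func (if [] ∈ Φ then annSym f else Sum.inr (baseSym f))
        (fun i => anno {ρ | (i : ℕ) :: ρ ∈ Φ} (ts i))

/-- Removal of all annotations strictly above the position `π`. -/
def disannoAbove : Position → ATrm L D V → ATrm L D V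
  | [], t => t
  | _ :: _, .var x => .var x
  | i :: π, .func f ts =>
      .func (Sum.inr (baseSym f) : (annot L D).Functions _)
        (fun j => if (j : ℕ) = i then disannoAbove π (ts j) else ts j)

/-- `Pos_{D^#}(t)`: the positions of annotated symbols. -/
def posAnn (t : ATrm L D V) : Set Position :=
  {π | ∃ (n : ℕ) (f : D n) (ts : Fin n → ATrm L D V),
    subtermAt t π = some (.func (Sum.inl f : (annot L D).Functions n) ts)}

/-- `r σ` for an annotated term `r` and a substitution `σ : V → T`. -/
def asubst (r : ATrm L D V) (σ : V → Trm L V) : ATrm L D V :=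
  r.subst (fun x => emb (σ x))

/-! ### Annotated dependency pairs -/

variable (L D V) in
/-- An annotated dependency pair `ℓ → {p₁ : r₁, …, p_k : r_k}^m`, where `ℓ = root(args)` and
`{p₁ : r₁, …, p_k : r_k}` is a finite multi-distribution. -/
structure ADP where
  /-- the arity of the root symbol of `ℓ` -/
  arity : ℕ
  /-- the root symbol of `ℓ`, a defined symbol -/
  root : D arity
  /-- the arguments of `ℓ` -/
  args : Fin arity → Trm L V
  /-- the right-hand side -/
  rhs : Multiset (ℝ × ATrm L D V)
  /-- the flag `m` -/
  flag : Bool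
  prob_pos : ∀ x ∈ rhs, 0 < x.1
  prob_le_one : ∀ x ∈ rhs, x.1 ≤ 1
  prob_sum : (rhs.map Prod.fst).sum = 1
  vars_subset : ∀ x ∈ rhs,
    vars x.2 ⊆ vars (FirstOrder.Language.Term.func (root : L.Functions arity) args)

/-- The left-hand side `ℓ`. -/
def ADP.lhs (α : ADP L D V) : Trm L V :=
  .func (α.root : L.Functions α.arity) α.args

/-- The annotated left-hand side `ℓ^#`. -/
def ADP.lhsSharp (α : ADP L D V) : ATrm L D V :=
  .func (Sum.inl α.root : (annot L D).Functions α.arity) (fun i => emb (α.args i))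

theorem subtermAt_emb_flat (t : ATrm L D V) (ρ : Position) :
    subtermAt (emb (flat t) : ATrm L D V) ρ = (subtermAt t ρ).map (fun s => emb (flat s)) := by
  induction ρ generalizing t with
  | nil => simp [subtermAt]
  | cons i ρ ih =>
    cases t with
    | var x => simp [subtermAt, flat, emb]
    | func f ts =>
      simp only [flat, emb, subtermAt]
      split
      · exact ih _
      · rfl

theorem vars_emb_flat (t : ATrm L D V) : vars (emb (flat t) : ATrm L D V) = vars t := by
  ext x
  simp only [vars, Set.mem_ofPred_eq, subtermAt_emb_flat, Option.map_eq_some_iff]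
  refine exists_congr fun ρ => ⟨?_, fun h => ⟨_, h, rfl⟩⟩
  rintro ⟨s, hs, h⟩
  cases s with
  | var y => simpa [flat, emb, hs] using h
  | func f ts => simp [flat, emb] at h

/-- `♭(ℓ → {p₁ : r₁, …, p_k : r_k}^m) = ℓ → {p₁ : ♭(r₁), …, p_k : ♭(r_k)}^m`. -/
def ADP.unannotate (α : ADP L D V) : ADP L D V where
  arity := α.arity
  root := α.root
  args := α.args
  rhs := α.rhs.map (fun x => (x.1, emb (flat x.2)))
  flag := α.flag
  prob_pos := by
    intro x hx
    obtain ⟨y, hy, rfl⟩ := Multiset.mem_map.1 hx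
    exact α.prob_pos y hy
  prob_le_one := by
    intro x hx
    obtain ⟨y, hy, rfl⟩ := Multiset.mem_map.1 hx
    exact α.prob_le_one y hy
  prob_sum := by
    rw [Multiset.map_map]
    exact α.prob_sum
  vars_subset := by
    intro x hx
    obtain ⟨y, hy, rfl⟩ := Multiset.mem_map.1 hx
    rw [vars_emb_flat]
    exact α.vars_subset y hy

/-! ### Rewriting with annotated dependency pairs

In both relations the redex position `π` automatically belongs to `Pos_{D ∪ D^#}(s)`, because the
root of every left-hand side is a defined symbol. The argument `ann` records whether the step is
performed at an annotated position (cases (at), (af)) or not (cases (nt), (nf)). -/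

/-- `t ∈ ANF_P` for `t ∈ T`: no left-hand side matches a proper subterm of `t`. -/
def ArgNormalForm (P : Set (ADP L D V)) (t : Trm L V) : Prop :=
  ¬ ∃ (ρ : Position) (t' : Trm L V) (α : ADP L D V) (σ : V → Trm L V),
    ρ ≠ [] ∧ subtermAt t ρ = some t' ∧ α ∈ P ∧ α.lhs.subst σ = t'

/-- Innermost rewriting with ADPs. -/
def InnermostStep (P : Set (ADP L D V)) (ann : Prop) (s : ATrm L D V)
    (μ : Multiset (ℝ × ATrm L D V)) : Prop :=
  ∃ α ∈ P, ∃ (σ : V → Trm L V) (π : Position) (redex : ATrm L D V),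
    subtermAt s π = some redex ∧ flat redex = α.lhs.subst σ ∧
    ArgNormalForm P (α.lhs.subst σ) ∧ (ann ↔ π ∈ posAnn s) ∧
    ((π ∈ posAnn s ∧ α.flag = true ∧
        μ = α.rhs.map (fun x => (x.1, replaceAt s π (asubst x.2 σ)))) ∨
     (π ∈ posAnn s ∧ α.flag = false ∧
        μ = α.rhs.map (fun x => (x.1, disannoAbove π (replaceAt s π (asubst x.2 σ))))) ∨
     (π ∉ posAnn s ∧ α.flag = true ∧
        μ = α.rhs.map (fun x => (x.1, replaceAt s π (emb ((flat x.2).subst σ))))) ∨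
     (π ∉ posAnn s ∧ α.flag = false ∧
        μ = α.rhs.map
          (fun x => (x.1, disannoAbove π (replaceAt s π (emb ((flat x.2).subst σ)))))))

/-- `φ` is a variable reposition function for the left-hand side `ℓ` and the right-hand side `r`
(`none` stands for `⊥`; only the values of `φ` on `Pos_V(ℓ)` matter). -/
def IsVRF (ℓ : Trm L V) (r : ATrm L D V) (φ : Position → Option Position) : Prop :=
  ∀ (ρ ρ' : Position) (x : V), subtermAt ℓ ρ = some (.var x) → φ ρ = some ρ' →
    subtermAt r ρ' = some (.var x)

/-- `Ψ = {φ(ρ).τ | ρ ∈ Pos_V(ℓ), φ(ρ) ≠ ⊥, ρ.τ ∈ Pos_{D^#}(redex)}`. -/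
def keptPos (ℓ : Trm L V) (φ : Position → Option Position) (redex : ATrm L D V) : Set Position :=
  {χ | ∃ (ρ ρ' τ : Position) (x : V), subtermAt ℓ ρ = some (.var x) ∧ φ ρ = some ρ' ∧
    ρ ++ τ ∈ posAnn redex ∧ χ = ρ' ++ τ}

/-- Full rewriting with ADPs. The multiset `M` equips every entry `p_j : r_j` of the right-hand
side with a variable reposition function `φ_j`. -/
def FullStep (P : Set (ADP L D V)) (ann : Prop) (s : ATrm L D V)
    (μ : Multiset (ℝ × ATrm L D V)) : Prop :=
  ∃ α ∈ P, ∃ (M : Multiset ((ℝ × ATrm L D V) × (Position → Option Position)))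
    (σ : V → Trm L V) (π : Position) (redex : ATrm L D V),
    M.map Prod.fst = α.rhs ∧ (∀ y ∈ M, IsVRF α.lhs y.1.2 y.2) ∧
    subtermAt s π = some redex ∧ flat redex = α.lhs.subst σ ∧ (ann ↔ π ∈ posAnn s) ∧
    ((π ∈ posAnn s ∧ α.flag = true ∧
        μ = M.map (fun y => (y.1.1,
          replaceAt s π (anno (posAnn y.1.2 ∪ keptPos α.lhs y.2 redex) (asubst y.1.2 σ))))) ∨
     (π ∈ posAnn s ∧ α.flag = false ∧
        μ = M.map (fun y => (y.1.1, disannoAbove π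
          (replaceAt s π (anno (posAnn y.1.2 ∪ keptPos α.lhs y.2 redex) (asubst y.1.2 σ)))))) ∨
     (π ∉ posAnn s ∧ α.flag = true ∧
        μ = M.map (fun y => (y.1.1,
          replaceAt s π (anno (keptPos α.lhs y.2 redex) (asubst y.1.2 σ))))))

/-! ### Chain trees and almost-sure termination -/

/-- A chain tree for the one-step relation `Step`, with node set `N`. Since chain trees are finitely
branching and hence countable, it suffices to consider node sets in `Type`. -/
structure ChainTree (Step : Prop → ATrm L D V → Multiset (ℝ × ATrm L D V) → Prop)
    (N : Type) where
  root : N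
  /-- the finite set of successors of a node -/
  children : N → Finset N
  root_not_child : ∀ a, root ∉ children a
  unique_parent : ∀ a b c, c ∈ children a → c ∈ children b → a = b
  reachable : ∀ a, Relation.ReflTransGen (fun b c => c ∈ children b) root a
  /-- the probability in the label of a node -/
  prob : N → ℝ
  /-- the term in the label of a node -/
  term : N → ATrm L D V
  prob_pos : ∀ a, 0 < prob a
  prob_le_one : ∀ a, prob a ≤ 1
  prob_root : prob root = 1
  /-- the inner nodes where a step at an annotated position is performed -/
  A : Set N
  A_inner : ∀ a ∈ A, (children a).Nonempty
  step : ∀ a, (children a).Nonempty →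
    Step (a ∈ A) (term a) ((children a).val.map (fun b => (prob b / prob a, term b)))
  infinite_path : ∀ path : ℕ → N, (∀ i, path (i + 1) ∈ children (path i)) →
    ∀ i, ∃ j, i ≤ j ∧ path j ∈ A

/-- `|T|_Leaf`, the sum of the probabilities of all leaves. -/
def ChainTree.leafProb {Step : Prop → ATrm L D V → Multiset (ℝ × ATrm L D V) → Prop} {N : Type}
    (T : ChainTree Step N) : ENNReal :=
  ∑' a : {a : N // T.children a = ∅}, ENNReal.ofReal (T.prob a)

/-- `P` is almost-surely terminating. -/
def AST (P : Set (ADP L D V)) : Prop :=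
  ∀ (N : Type) (T : ChainTree (FullStep P) N), T.leafProb = 1

/-- `P` is almost-surely innermost terminating. -/
def IAST (P : Set (ADP L D V)) : Prop :=
  ∀ (N : Type) (T : ChainTree (InnermostStep P) N), T.leafProb = 1

/-! ### Processors -/

/-- Replacing `P` by the ADP problems in `Q` is sound for the property `Z`. -/
def SoundFor (Z : Set (ADP L D V) → Prop) (P : Set (ADP L D V)) (Q : Set (Set (ADP L D V))) :
    Prop :=
  (∀ P' ∈ Q, Z P') → Z P

/-- Replacing `P` by the ADP problems in `Q` is complete for the property `Z`. -/
def CompleteFor (Z : Set (ADP L D V) → Prop) (P : Set (ADP L D V)) (Q : Set (Set (ADP L D V))) :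
    Prop :=
  Z P → ∀ P' ∈ Q, Z P'

/-! ### Polynomial interpretations -/

variable (L D) in
/-- A polynomial interpretation assigns to every `n`-ary symbol of `Σ^#` a polynomial in `n`
variables with natural coefficients. -/
def PolInterp := ∀ n : ℕ, (annot L D).Functions n → MvPolynomial (Fin n) ℕ

/-- All exponents in all monomials are `0` or `1`. -/
def PolInterp.Multilinear (I : PolInterp L D) : Prop :=
  ∀ (n : ℕ) (f : (annot L D).Functions n), ∀ m ∈ (I n f).support, ∀ i, m i ≤ 1

/-- `Pol(t)` for an annotated term `t`. -/
def PolInterp.pol (I : PolInterp L D) : ATrm L D V → MvPolynomial V ℕ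
  | .var x => MvPolynomial.X x
  | .func f ts => MvPolynomial.bind₁ (fun i => I.pol (ts i)) (I _ f)

/-- The `#`-sum of `t`: the sum of `Pol((♭(t|_π))^#)` over all positions `π` of annotated symbols
of `t`. -/
def PolInterp.sharpSum (I : PolInterp L D) : ATrm L D V → MvPolynomial V ℕ
  | .var _ => 0
  | @FirstOrder.Language.Term.func _ _ n f ts =>
      (match (f : D n ⊕ L.Functions n) with
        | Sum.inl g => I.pol (.func (Sum.inl g : (annot L D).Functions n)
            (fun i => emb (flat (ts i))))
        | Sum.inr _ => 0) + ∑ i, I.sharpSum (ts i)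

/-- The value of a polynomial with natural coefficients under an instantiation of its variables by
natural numbers, as a real number. -/
def val (a : V → ℕ) (q : MvPolynomial V ℕ) : ℝ := ((MvPolynomial.eval a q : ℕ) : ℝ)

/-- The expected value `∑_j p_j ⋅ g(r_j)` under an instantiation of the variables. -/
def expVal (a : V → ℕ) (g : ATrm L D V → MvPolynomial V ℕ) (μ : Multiset (ℝ × ATrm L D V)) : ℝ :=
  (μ.map (fun x => x.1 * val a (g x.2))).sum

end ADPFramework

end

open ADPFramework

/-!
The `#`-sum of a term, evaluated at the instantiation that sends every variable to `0`, is a rank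
with values in `ℕ`. It does not increase in expectation along rewrite steps with `P`. Indeed, by
multilinearity `Pol(C[t])` is an affine function of `Pol(t)` for every context `C`, so that the weak
orientation of the rules passes to the annotated subterms above the redex
(`evSharp_replaceAt`). Annotations that a full step carries over from proper subterms of the redex
are paid for by the `#`-sum of the redex, because a variable reposition function moves every annotated
position to at most one place (`tsum_keptPos_le`, where the `#`-sum is written as a sum over
positions).
A step at an annotated position with an ADP from `P_>` moreover decreases the rank with
probability at least `ε`, where `ε > 0` depends only on the finite set `P`. All other steps are
possible with the processed problem `P_≥ ∪ ♭(P_>)` as well.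

Soundness is therefore a statement about trees with a rank `x`, whose parts between decreasing nodes
terminate almost surely (`leafProb_eq_one_of_rank`). Let `nonterm a` be the conditional probability
of never reaching a leaf from the node `a`. It is harmonic, and a maximum principle holds: if a
subharmonic function bounded by `1` is nonpositive at the leaves and at the decreasing nodes, then
it is nonpositive everywhere (`ChainTree.nonpos_of_subharmonic`); this is where almost-sure
termination of the processed problem is applied, to the tree that is cut at the decreasing nodes. The potential
`φ x = 2 - 2 ^ (-x)` is strictly concave in the rank, so for ranks below `K` its expectation
decreases by a fixed factor `θ < 1` at each decreasing node. With the maximum principle, induction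
on `m` shows `nonterm a ≤ x a / K + θ ^ m * φ (x a)`, where the first summand takes care of
the ranks from `K` on. Now let `m → ∞` and then `K → ∞`.

For completeness, every step with the processed problem can be repeated with `P` on a term with more
annotations, so that a chain tree of the processed problem can be relabelled to a chain tree of `P`
of the same shape (`ChainTree.exists_leafProb_eq_of_stepLifts`).
-/

namespace ADPFramework
open FirstOrder.Language Filter Topology

variable {L : FirstOrder.Language.{u, w}} {D : ∀ n, Set (L.Functions n)} {V : Type v}

/-! ### Terms, subterms and annotations -/

theorem flat_emb (t : Trm L V) : flat (emb t : ATrm L D V) = t := by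
  induction t with
  | var x => rfl
  | func f ts ih => simp [emb, flat, baseSym, ih]

theorem flat_asubst (t : ATrm L D V) (σ : V → Trm L V) :
    flat (asubst t σ) = (flat t).subst σ := by
  induction t with
  | var x => exact flat_emb _
  | func f ts ih => simpa [asubst, flat, Term.subst, funext_iff] using ih

theorem asubst_emb (t : Trm L V) (σ : V → Trm L V) :
    asubst (emb t : ATrm L D V) σ = emb (t.subst σ) := by
  induction t with
  | var x => rfl
  | func f ts ih => exact congrArg (Term.func _) (funext ih)

theorem asubst_emb_flat (t : ATrm L D V) (σ : V → Trm L V) :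
    asubst (emb (flat t) : ATrm L D V) σ = emb (flat (asubst t σ)) := by
  rw [asubst_emb, flat_asubst]

theorem subtermAt_append (t : L.Term V) (ρ τ : Position) :
    subtermAt t (ρ ++ τ) = (subtermAt t ρ).bind (fun s => subtermAt s τ) := by
  induction ρ generalizing t with
  | nil => simp [subtermAt]
  | cons i ρ ih =>
    cases t with
    | var x => simp [subtermAt]
    | func f ts =>
      simp only [List.cons_append, subtermAt]
      split
      · exact ih _
      · rfl

theorem subtermAt_flat (t : ATrm L D V) (ρ : Position) :
    subtermAt (flat t) ρ = (subtermAt t ρ).map flat := by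
  induction ρ generalizing t with
  | nil => simp [subtermAt]
  | cons i ρ ih =>
    cases t with
    | var x => simp [subtermAt, flat]
    | func f ts =>
      simp only [flat, subtermAt]
      split
      · exact ih _
      · rfl

theorem subtermAt_subst {t s : L.Term V} (σ : V → L.Term V) {ρ : Position}
    (h : subtermAt t ρ = some s) : subtermAt (t.subst σ) ρ = some (s.subst σ) := by
  induction ρ generalizing t with
  | nil => simp_all [subtermAt]
  | cons i ρ ih =>
    cases t with
    | var x => simp [subtermAt] at h
    | func f ts =>
      simp only [subtermAt, Term.subst] at h ⊢
      split at h
      · next hi => simpa [hi] using ih h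
      · simp at h

theorem subtermAt_emb_flat_eq_var {t : ATrm L D V} {ρ : Position} {x : V} :
    subtermAt (emb (flat t) : ATrm L D V) ρ = some (.var x) ↔ subtermAt t ρ = some (.var x) := by
  rw [subtermAt_emb_flat, Option.map_eq_some_iff]
  constructor
  · rintro ⟨s, hs, h⟩
    cases s with
    | var y => simpa [flat, emb, hs] using h
    | func f ts => simp [flat, emb] at h
  · exact fun h => ⟨_, h, rfl⟩

/-- A variable position is minimal: distinct variable positions are incomparable as prefixes, so a
position below a variable position determines it. -/
theorem var_position_unique {t : L.Term V} {ρ₁ ρ₂ τ₁ τ₂ : Position} {x₁ x₂ : V}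
    (h₁ : subtermAt t ρ₁ = some (.var x₁)) (h₂ : subtermAt t ρ₂ = some (.var x₂))
    (h : ρ₁ ++ τ₁ = ρ₂ ++ τ₂) : ρ₁ = ρ₂ ∧ τ₁ = τ₂ := by
  have key : ∀ {ρ₁ ρ₂ : Position} {x₁ x₂ : V} {c : Position}, subtermAt t ρ₁ = some (.var x₁) →
      subtermAt t ρ₂ = some (.var x₂) → ρ₂ = ρ₁ ++ c → c = [] := by
    intro ρ₁ ρ₂ x₁ x₂ c h₁ h₂ h
    subst h
    rw [subtermAt_append, h₁] at h₂
    cases c with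
    | nil => rfl
    | cons i c => simp [subtermAt] at h₂
  rcases List.append_eq_append_iff.1 h with ⟨c, hc, hc'⟩ | ⟨c, hc, hc'⟩
  · obtain rfl := key h₁ h₂ hc
    simp_all
  · obtain rfl := key h₂ h₁ hc
    simp_all

theorem replaceAt_self {t s : L.Term V} {π : Position} (h : subtermAt t π = some s) :
    replaceAt t π s = t := by
  induction π generalizing t with
  | nil => simp_all [subtermAt, replaceAt]
  | cons i π ih =>
    cases t with
    | var x => simp [subtermAt] at h
    | func f ts =>
      simp only [subtermAt] at h
      split at h
      · next hi =>
        simp only [replaceAt]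
        congr 1
        funext j
        split
        · next hj => subst hj; exact ih h
        · rfl
      · simp at h

theorem baseSym_annSym {n : ℕ} (f : (annot L D).Functions n) : baseSym (annSym f) = baseSym f := by
  by_cases h : baseSym f ∈ D n
  · rw [show annSym f = Sum.inl ⟨baseSym f, h⟩ from dif_pos h]
    rfl
  · exact congrArg baseSym (dif_neg h)

theorem anno_func_of_mem {Φ : Set Position} (h : [] ∈ Φ) {n : ℕ} (f : (annot L D).Functions n)
    (ts : Fin n → ATrm L D V) :
    anno Φ (.func f ts) = .func (annSym f) (fun i => anno {ρ | (i : ℕ) :: ρ ∈ Φ} (ts i)) := by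
  rw [anno]
  congr 1
  exact if_pos h

theorem anno_func_of_notMem {Φ : Set Position} (h : [] ∉ Φ) {n : ℕ} (f : (annot L D).Functions n)
    (ts : Fin n → ATrm L D V) :
    anno Φ (.func f ts) = .func (Sum.inr (baseSym f) : (annot L D).Functions n)
      (fun i => anno {ρ | (i : ℕ) :: ρ ∈ Φ} (ts i)) := by
  rw [anno]
  congr 1
  exact if_neg h

theorem flat_anno (Φ : Set Position) (t : ATrm L D V) : flat (anno Φ t) = flat t := by
  induction t generalizing Φ with
  | var x => rfl
  | func f ts ih =>
    by_cases h : [] ∈ Φ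
    · simp only [anno_func_of_mem h, flat, ih, baseSym_annSym]
    · simp only [anno_func_of_notMem h, flat, ih]
      rfl

theorem annSym_inr_baseSym {n : ℕ} (f : (annot L D).Functions n) :
    annSym (Sum.inr (baseSym f) : (annot L D).Functions n) = annSym f := by
  rcases f with f | f
  · have h : baseSym (Sum.inl f : (annot L D).Functions n) ∈ D n := f.2
    exact (dif_pos h : annSym (Sum.inr _) = Sum.inl ⟨_, h⟩).trans
      (dif_pos h : annSym (Sum.inl f) = Sum.inl ⟨_, h⟩).symm
  · rfl

theorem anno_emb_flat (Φ : Set Position) (t : ATrm L D V) : anno Φ (emb (flat t)) = anno Φ t := by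
  induction t generalizing Φ with
  | var x => rfl
  | func f ts ih =>
    simp only [flat, emb, anno, ih]
    congr 1
    rw [annSym_inr_baseSym]
    rfl

theorem nil_mem_posAnn_inl {n : ℕ} (f : D n) (ts : Fin n → ATrm L D V) :
    [] ∈ posAnn (.func (Sum.inl f : (annot L D).Functions n) ts) :=
  ⟨n, f, ts, rfl⟩

theorem nil_notMem_posAnn_inr {n : ℕ} (f : L.Functions n) (ts : Fin n → ATrm L D V) :
    [] ∉ posAnn (.func (Sum.inr f : (annot L D).Functions n) ts) := by
  rintro ⟨m, g, us, h⟩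
  simp only [subtermAt, Option.some.injEq] at h
  cases h

theorem cons_mem_posAnn {n : ℕ} (f : (annot L D).Functions n) (ts : Fin n → ATrm L D V)
    {i : ℕ} {π : Position} :
    i :: π ∈ posAnn (.func f ts) ↔ ∃ h : i < n, π ∈ posAnn (ts ⟨i, h⟩) := by
  by_cases hi : i < n <;> simp [posAnn, subtermAt, hi]

theorem posAnn_var (x : V) : posAnn (.var x : ATrm L D V) = ∅ := by
  ext π
  cases π <;> simp [posAnn, subtermAt]

theorem posAnn_anno_subset (Φ : Set Position) (t : ATrm L D V) : posAnn (anno Φ t) ⊆ Φ := by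
  intro π
  induction π generalizing t Φ with
  | nil =>
    cases t with
    | var x => simp [anno, posAnn_var]
    | func f ts =>
      intro h
      by_contra h'
      rw [anno_func_of_notMem h'] at h
      exact nil_notMem_posAnn_inr _ _ h
  | cons i π ih =>
    cases t with
    | var x => simp [anno, posAnn_var]
    | func f ts =>
      simp only [anno, cons_mem_posAnn]
      rintro ⟨h, h'⟩
      exact ih _ _ h'

theorem posAnn_subset_asubst (t : ATrm L D V) (σ : V → Trm L V) :
    posAnn t ⊆ posAnn (asubst t σ) := by
  rintro π ⟨n, f, ts, h⟩
  exact ⟨n, f, _, subtermAt_subst _ h⟩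

theorem mem_posAnn_iff_of_subtermAt {s t : ATrm L D V} {π : Position} (h : subtermAt s π = some t)
    (τ : Position) : π ++ τ ∈ posAnn s ↔ τ ∈ posAnn t := by
  simp [posAnn, subtermAt_append, h]

/-! ### Numerical interpretations of terms -/

/-- `Pol(t)` at the instantiation `a`. -/
noncomputable def PolInterp.ev (I : PolInterp L D) (a : V → ℕ) (t : ATrm L D V) : ℕ :=
  MvPolynomial.eval a (I.pol t)

/-- The `#`-sum of `t` at the instantiation `a`. -/
noncomputable def PolInterp.evSharp (I : PolInterp L D) (a : V → ℕ) (t : ATrm L D V) : ℕ :=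
  MvPolynomial.eval a (I.sharpSum t)

/-- The contribution of the root of an annotated term to its `#`-sum, as a function of the root
symbol and the values of the arguments. -/
noncomputable def PolInterp.rootVal (I : PolInterp L D) {n : ℕ} (f : (annot L D).Functions n)
    (y : Fin n → ℕ) : ℕ :=
  match (f : D n ⊕ L.Functions n) with
  | Sum.inl g => MvPolynomial.eval y (I n (Sum.inl g : (annot L D).Functions n))
  | Sum.inr _ => 0

theorem ev_func (I : PolInterp L D) (a : V → ℕ) {n : ℕ} (f : (annot L D).Functions n)
    (ts : Fin n → ATrm L D V) :
    I.ev a (.func f ts) = MvPolynomial.eval (fun i => I.ev a (ts i)) (I n f) :=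
  MvPolynomial.eval₂Hom_bind₁ (RingHom.id ℕ) a (fun i => I.pol (ts i)) (I n f)

theorem evSharp_func (I : PolInterp L D) (a : V → ℕ) {n : ℕ} (f : (annot L D).Functions n)
    (ts : Fin n → ATrm L D V) :
    I.evSharp a (.func f ts) =
      I.rootVal f (fun i => I.ev a (emb (flat (ts i)))) + ∑ i, I.evSharp a (ts i) := by
  rcases f with f | f
  · simp only [PolInterp.evSharp, PolInterp.sharpSum, map_add, map_sum]
    congr 1
    exact ev_func I a _ _
  · simp only [PolInterp.evSharp, PolInterp.sharpSum, map_add, map_sum, map_zero]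
    rfl

theorem ev_asubst (I : PolInterp L D) (a : V → ℕ) (σ : V → Trm L V) (t : ATrm L D V) :
    I.ev a (asubst t σ) = I.ev (fun x => I.ev a (emb (σ x))) t := by
  induction t with
  | var x => simp [asubst, PolInterp.ev, PolInterp.pol, Term.subst]
  | func f ts ih =>
    refine (ev_func I a f _).trans ((congrArg (fun y => MvPolynomial.eval y _) (funext ih)).trans
      (ev_func I _ f ts).symm)

theorem evSharp_emb (I : PolInterp L D) (a : V → ℕ) (t : Trm L V) :
    I.evSharp a (emb t) = 0 := by
  induction t with
  | var x => simp [PolInterp.evSharp, PolInterp.sharpSum, emb]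
  | func f ts ih =>
    refine (evSharp_func I a _ _).trans ?_
    simp [ih, PolInterp.rootVal]

theorem evSharp_asubst (I : PolInterp L D) (a : V → ℕ) (σ : V → Trm L V) (t : ATrm L D V) :
    I.evSharp a (asubst t σ) = I.evSharp (fun x => I.ev a (emb (σ x))) t := by
  induction t with
  | var x =>
    refine (evSharp_emb I a (σ x)).trans ?_
    simp [PolInterp.evSharp, PolInterp.sharpSum]
  | func f ts ih =>
    refine (evSharp_func I a f _).trans (Eq.trans ?_ (evSharp_func I _ f ts).symm)
    refine congrArg₂ (· + ·) (congrArg (I.rootVal f) (funext fun i => ?_))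
      (Finset.sum_congr rfl fun i _ => ih i)
    rw [← ev_asubst, asubst_emb_flat]
    rfl

/-! ### Contexts -/

/-- A polynomial in which a variable has exponent at most one is affine in this variable. -/
theorem eval_affine {n : ℕ} (p : MvPolynomial (Fin n) ℕ) (i : Fin n)
    (hp : ∀ m ∈ p.support, m i ≤ 1) (y : Fin n → ℕ) :
    ∃ A B : ℕ, ∀ c : ℕ, MvPolynomial.eval (Function.update y i c) p = A + B * c := by
  have hm : ∀ m ∈ p.support, ∃ A B : ℕ, ∀ c : ℕ,
      p.coeff m * ∏ j, Function.update y i c j ^ m j = A + B * c := by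
    intro m hm
    have hrest : ∀ c : ℕ, ∏ j, Function.update y i c j ^ m j =
        c ^ m i * ∏ j ∈ Finset.univ.erase i, y j ^ m j := by
      intro c
      rw [← Finset.mul_prod_erase _ _ (Finset.mem_univ i), Function.update_self]
      congr 1
      exact Finset.prod_congr rfl fun j hj => by
        rw [Function.update_of_ne (Finset.ne_of_mem_erase hj)]
    rcases Nat.le_one_iff_eq_zero_or_eq_one.1 (hp m hm) with h | h
    · exact ⟨p.coeff m * ∏ j ∈ Finset.univ.erase i, y j ^ m j, 0, fun c => by
        rw [hrest, h]; ring⟩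
    · exact ⟨0, p.coeff m * ∏ j ∈ Finset.univ.erase i, y j ^ m j, fun c => by
        rw [hrest, h]; ring⟩
  choose! A B hAB using hm
  refine ⟨∑ m ∈ p.support, A m, ∑ m ∈ p.support, B m, fun c => ?_⟩
  rw [MvPolynomial.eval_eq', Finset.sum_mul, ← Finset.sum_add_distrib]
  exact Finset.sum_congr rfl fun m hm => hAB m hm c

theorem rootVal_affine {I : PolInterp L D} (hI : I.Multilinear) {n : ℕ}
    (f : (annot L D).Functions n) (i : Fin n) (y : Fin n → ℕ) :
    ∃ A B : ℕ, ∀ c : ℕ, I.rootVal f (Function.update y i c) = A + B * c := by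
  rcases f with f | f
  · exact eval_affine _ i (fun m hm => hI n _ m hm i) y
  · exact ⟨0, 0, fun c => by simp [PolInterp.rootVal]⟩

theorem ev_emb_flat_replaceAt {I : PolInterp L D} (hI : I.Multilinear) (a : V → ℕ)
    (s : ATrm L D V) (π : Position) (redex : ATrm L D V) (h : subtermAt s π = some redex) :
    ∃ A B : ℕ, ∀ r, I.ev a (emb (flat (replaceAt s π r))) = A + B * I.ev a (emb (flat r)) := by
  induction π generalizing s with
  | nil => exact ⟨0, 1, fun r => by simp [replaceAt]⟩
  | cons i π ih =>
    cases s with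
    | var x => simp [subtermAt] at h
    | @func n f ts =>
      simp only [subtermAt] at h
      split at h
      next hi =>
        obtain ⟨A, B, hAB⟩ := ih _ h
        obtain ⟨A', B', hAB'⟩ := eval_affine
          (I n (Sum.inr (baseSym f) : (annot L D).Functions n)) ⟨i, hi⟩
          (fun m hm => hI n _ m hm _) (fun j => I.ev a (emb (flat (ts j))))
        refine ⟨A' + B' * A, B' * B, fun r => ?_⟩
        refine (ev_func I a _ _).trans ?_
        have : (fun j : Fin n => I.ev a (emb (flat
            (if (j : ℕ) = i then replaceAt (ts j) π r else ts j)))) =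
            Function.update (fun j => I.ev a (emb (flat (ts j)))) ⟨i, hi⟩
              (A + B * I.ev a (emb (flat r))) := by
          funext j
          by_cases hj : j = ⟨i, hi⟩
          · subst hj
            simp [hAB]
          · have : (j : ℕ) ≠ i := fun h => hj (Fin.ext h)
            simp [this, hj]
        rw [this, hAB']
        ring
      next => simp at h

/-- The `#`-sum of `s[r]_π` is an affine function of `Pol(♭(r))` and of the `#`-sum of `r`; the
annotations strictly above `π` are responsible for the summand `B ⋅ Pol(♭(r))` and for the
difference between `A` and `A'`. -/
theorem evSharp_replaceAt {I : PolInterp L D} (hI : I.Multilinear) (a : V → ℕ)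
    (s : ATrm L D V) (π : Position) (redex : ATrm L D V) (h : subtermAt s π = some redex) :
    ∃ A A' B : ℕ, A' ≤ A ∧
      (∀ r, I.evSharp a (replaceAt s π r) = A + B * I.ev a (emb (flat r)) + I.evSharp a r) ∧
      ∀ r, I.evSharp a (disannoAbove π (replaceAt s π r)) = A' + I.evSharp a r := by
  induction π generalizing s with
  | nil => exact ⟨0, 0, 0, le_rfl, fun r => by simp [replaceAt], fun r => by
      simp [replaceAt, disannoAbove]⟩
  | cons i π ih =>
    cases s with
    | var x => simp [subtermAt] at h
    | @func n f ts =>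
      simp only [subtermAt] at h
      split at h
      next hi =>
        obtain ⟨A, A', B, hle, h₁, h₂⟩ := ih _ h
        obtain ⟨E, F, hEF⟩ := ev_emb_flat_replaceAt hI a _ _ _ h
        obtain ⟨G, H, hGH⟩ := rootVal_affine hI f ⟨i, hi⟩ (fun j => I.ev a (emb (flat (ts j))))
        have hsplit : ∀ g : ATrm L D V → ATrm L D V,
            ∑ j : Fin n, I.evSharp a (if (j : ℕ) = i then g (ts j) else ts j) =
            I.evSharp a (g (ts ⟨i, hi⟩)) +
              ∑ j ∈ Finset.univ.erase ⟨i, hi⟩, I.evSharp a (ts j) := by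
          intro g
          rw [← Finset.add_sum_erase _ _ (Finset.mem_univ (⟨i, hi⟩ : Fin n)), if_pos rfl]
          congr 1
          refine Finset.sum_congr rfl fun j hj => ?_
          rw [if_neg fun h => Finset.ne_of_mem_erase hj (Fin.ext h)]
        set R := ∑ j ∈ Finset.univ.erase (⟨i, hi⟩ : Fin n), I.evSharp a (ts j)
        refine ⟨G + H * E + A + R, A' + R, H * F + B, by omega, fun r => ?_, fun r => ?_⟩
        · refine (evSharp_func I a _ _).trans ?_
          have : (fun j : Fin n => I.ev a (emb (flat
              (if (j : ℕ) = i then replaceAt (ts j) π r else ts j)))) =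
              Function.update (fun j => I.ev a (emb (flat (ts j)))) ⟨i, hi⟩
                (E + F * I.ev a (emb (flat r))) := by
            funext j
            by_cases hj : j = ⟨i, hi⟩
            · subst hj
              simp [hEF]
            · have : (j : ℕ) ≠ i := fun h => hj (Fin.ext h)
              simp [this, hj]
          rw [this, hGH, hsplit fun t => replaceAt t π r, h₁]
          ring
        · refine (evSharp_func I a _ _).trans ?_
          have : ∀ j : Fin n, (if (j : ℕ) = i then
                disannoAbove π (if (j : ℕ) = i then replaceAt (ts j) π r else ts j)
              else if (j : ℕ) = i then replaceAt (ts j) π r else ts j) =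
              if (j : ℕ) = i then disannoAbove π (replaceAt (ts j) π r) else ts j := by
            intro j
            split <;> rfl
          simp only [this]
          rw [hsplit fun t => disannoAbove π (replaceAt t π r), h₂]
          simp only [PolInterp.rootVal]
          ring
      next => simp at h

/-! ### The `#`-sum as a sum over positions -/

open Classical in
/-- The value `Pol((t|_π)^#)` at the instantiation `a`, with the value `0` if `π` is not a position
of a defined symbol. The values are taken in `ENNReal` so that arbitrary sets of positions can be
summed over. -/
noncomputable def PolInterp.posVal (I : PolInterp L D) (a : V → ℕ) (t : Trm L V) (π : Position) :
    ENNReal :=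
  match subtermAt t π with
  | some (@FirstOrder.Language.Term.func _ _ n f ts) =>
    if h : f ∈ D n then
      (I.ev a (.func (Sum.inl ⟨f, h⟩ : (annot L D).Functions n) (fun i => emb (ts i))) : ENNReal)
    else 0
  | _ => 0

theorem posVal_congr (I : PolInterp L D) (a : V → ℕ) {t t' : Trm L V} {π π' : Position}
    (h : subtermAt t π = subtermAt t' π') : I.posVal a t π = I.posVal a t' π' := by
  simp only [PolInterp.posVal, h]

theorem tsum_position (F : Position → ENNReal) :
    ∑' π, F π = F [] + ∑' i, ∑' π, F (i :: π) := by
  let e : Unit ⊕ (ℕ × Position) ≃ Position :=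
    { toFun := Sum.elim (fun _ => []) (fun p => p.1 :: p.2)
      invFun := fun l => match l with
        | [] => Sum.inl ()
        | i :: π => Sum.inr (i, π)
      left_inv := by rintro (_ | _) <;> rfl
      right_inv := by rintro (_ | _) <;> rfl }
  rw [← e.tsum_eq, ENNReal.summable.tsum_sum ENNReal.summable]
  rw [ENNReal.tsum_prod']
  simp [e]

theorem evSharp_eq_tsum (I : PolInterp L D) (a : V → ℕ) (t : ATrm L D V) :
    (I.evSharp a t : ENNReal) = ∑' π, (posAnn t).indicator (I.posVal a (flat t)) π := by
  induction t with
  | var x => simp [posAnn_var, PolInterp.evSharp, PolInterp.sharpSum]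
  | @func n f ts ih =>
    rw [evSharp_func, tsum_position, Nat.cast_add, Nat.cast_sum]
    congr 1
    · rcases f with f | f
      · rw [Set.indicator_of_mem (nil_mem_posAnn_inl f ts)]
        refine Eq.trans ?_ (dif_pos f.2).symm
        exact congrArg Nat.cast (ev_func I a _ _).symm
      · rw [Set.indicator_of_notMem (nil_notMem_posAnn_inr f ts)]
        exact Nat.cast_zero
    · rw [tsum_eq_sum (s := Finset.range n), Finset.sum_range]
      · refine Finset.sum_congr rfl fun i _ => (ih i).trans (tsum_congr fun π => ?_)
        have hmem : (i : ℕ) :: π ∈ posAnn (.func f ts) ↔ π ∈ posAnn (ts i) := by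
          simp [cons_mem_posAnn]
        have hval : I.posVal a (flat (.func f ts)) (i :: π) = I.posVal a (flat (ts i)) π :=
          posVal_congr I a (by simp [flat, subtermAt])
        by_cases h : π ∈ posAnn (ts i)
        · rw [Set.indicator_of_mem h, Set.indicator_of_mem (hmem.2 h), hval]
        · rw [Set.indicator_of_notMem h, Set.indicator_of_notMem (mt hmem.1 h)]
      · intro i hi
        refine ENNReal.tsum_eq_zero.2 fun π => Set.indicator_of_notMem ?_ _
        rw [cons_mem_posAnn]
        rintro ⟨h, -⟩
        exact hi (Finset.mem_range.2 h)

theorem evSharp_anno_le_tsum (I : PolInterp L D) (a : V → ℕ) (Φ : Set Position) (t : ATrm L D V) :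
    (I.evSharp a (anno Φ t) : ENNReal) ≤ ∑' π, Φ.indicator (I.posVal a (flat t)) π := by
  rw [evSharp_eq_tsum, flat_anno]
  exact ENNReal.tsum_le_tsum fun π =>
    Set.indicator_le_indicator_of_subset (posAnn_anno_subset Φ t) (fun _ => zero_le) π

/-- Annotations that a variable reposition function carries over from the redex contribute at most
the `#`-sum of the redex: every annotated position of the redex is moved to at most one place,
because it lies below at most one variable position of the left-hand side. -/
theorem tsum_keptPos_le (I : PolInterp L D) (a : V → ℕ) {ℓ : Trm L V} {r : ATrm L D V}
    {φ : Position → Option Position} (hφ : IsVRF ℓ r φ) {σ : V → Trm L V} {q : ATrm L D V}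
    (hq : flat q = ℓ.subst σ) :
    ∑' π, (keptPos ℓ φ q).indicator (I.posVal a (flat (asubst r σ))) π ≤
      (I.evSharp a q : ENNReal) := by
  rw [evSharp_eq_tsum, ← tsum_subtype, ← tsum_subtype]
  choose! ρ ρ' τ x h₁ h₂ h₃ h₄ using
    fun (χ : Position) (hχ : χ ∈ keptPos ℓ φ q) => hχ
  let g : keptPos ℓ φ q → posAnn q := fun χ => ⟨ρ χ ++ τ χ, h₃ χ χ.2⟩
  have hg : Function.Injective g := by
    intro χ χ' h
    have h := congrArg Subtype.val h
    obtain ⟨e₁, e₂⟩ := var_position_unique (h₁ χ χ.2) (h₁ χ' χ'.2) h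
    have e₃ := h₂ χ χ.2
    rw [e₁, h₂ χ' χ'.2, Option.some.injEq] at e₃
    exact Subtype.ext (by rw [h₄ χ χ.2, h₄ χ' χ'.2, e₂, e₃])
  refine le_trans (le_of_eq (tsum_congr fun χ => ?_))
    (ENNReal.tsum_comp_le_tsum_of_injective hg fun π => I.posVal a (flat q) π)
  refine posVal_congr I a ?_
  have hr := hφ _ _ _ (h₁ χ χ.2) (h₂ χ χ.2)
  rw [flat_asubst, hq, subtermAt_append, subtermAt_subst σ (h₁ χ χ.2)]
  conv_lhs => rw [h₄ χ χ.2, subtermAt_append, subtermAt_subst σ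
    (show subtermAt (flat r) (ρ' χ) = some (.var (x χ χ.2)) by rw [subtermAt_flat, hr]; rfl)]

theorem evSharp_anno_union_keptPos_le (I : PolInterp L D) (a : V → ℕ) {ℓ : Trm L V}
    {r : ATrm L D V} {φ : Position → Option Position} (hφ : IsVRF ℓ r φ) {σ : V → Trm L V}
    {q : ATrm L D V} (hq : flat q = ℓ.subst σ) :
    I.evSharp a (anno (posAnn r ∪ keptPos ℓ φ q) (asubst r σ)) ≤
      I.evSharp a (asubst r σ) + I.evSharp a q := by
  have h : (I.evSharp a (anno (posAnn r ∪ keptPos ℓ φ q) (asubst r σ)) : ENNReal) ≤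
      I.evSharp a (asubst r σ) + I.evSharp a q := by
    refine (evSharp_anno_le_tsum I a _ _).trans (le_trans ?_
      (add_le_add (evSharp_eq_tsum I a (asubst r σ)).ge (tsum_keptPos_le I a hφ hq)))
    rw [← tsum_subtype, ← tsum_subtype, ← tsum_subtype (keptPos ℓ φ q)]
    refine (ENNReal.tsum_union_le _ _ _).trans (add_le_add_left ?_ _)
    exact ENNReal.tsum_mono_subtype _ (posAnn_subset_asubst r σ)
  exact_mod_cast h

theorem evSharp_anno_keptPos_le (I : PolInterp L D) (a : V → ℕ) {ℓ : Trm L V}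
    {r : ATrm L D V} {φ : Position → Option Position} (hφ : IsVRF ℓ r φ) {σ : V → Trm L V}
    {q : ATrm L D V} (hq : flat q = ℓ.subst σ) :
    I.evSharp a (anno (keptPos ℓ φ q) (asubst r σ)) ≤ I.evSharp a q := by
  exact_mod_cast (evSharp_anno_le_tsum I a _ _).trans (tsum_keptPos_le I a hφ hq)

/-! ### Redexes -/

theorem exists_eq_func_of_flat_eq {t : ATrm L D V} {n : ℕ} {f : L.Functions n}
    {us : Fin n → Trm L V} (h : flat t = .func f us) :
    ∃ (g : (annot L D).Functions n) (ts : Fin n → ATrm L D V),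
      t = .func g ts ∧ baseSym g = f ∧ us = fun i => flat (ts i) := by
  cases t with
  | var x => simp [flat] at h
  | func g ts =>
    simp only [flat, Term.func.injEq] at h
    obtain ⟨rfl, h₁, h₂⟩ := h
    exact ⟨g, ts, rfl, eq_of_heq h₁, (eq_of_heq h₂).symm⟩

/-- The `#`-sum of a redex splits into the contribution of its root and the `#`-sum of `q`, the
redex without the annotation of its root. Positions below variable positions of the left-hand side are not
affected by this change, because a left-hand side is not a variable. -/
theorem exists_redex_without_root (I : PolInterp L D) (a : V → ℕ) {α : ADP L D V}
    {σ : V → Trm L V} {redex : ATrm L D V} (h : flat redex = α.lhs.subst σ) :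
    ∃ q : ATrm L D V, flat q = α.lhs.subst σ ∧
      (∀ φ, keptPos α.lhs φ redex = keptPos α.lhs φ q) ∧
      I.evSharp a q ≤ I.evSharp a redex ∧
      ([] ∈ posAnn redex → I.ev a (asubst α.lhsSharp σ) + I.evSharp a q ≤ I.evSharp a redex) := by
  obtain ⟨f, ts, rfl, hf, hts⟩ := exists_eq_func_of_flat_eq h
  refine ⟨.func (Sum.inr (baseSym f) : (annot L D).Functions α.arity) ts, h, fun φ => ?_, ?_, ?_⟩
  · have hne : ∀ {ρ : Position} {x : V}, subtermAt α.lhs ρ = some (.var x) →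
        ∃ i ρ', ρ = i :: ρ' := by
      intro ρ x hρ
      cases ρ with
      | nil => simp [subtermAt, ADP.lhs] at hρ
      | cons i ρ => exact ⟨i, ρ, rfl⟩
    ext χ
    refine exists_congr fun ρ => exists_congr fun ρ' => exists_congr fun τ => exists_congr fun x =>
      and_congr_right fun hρ => ?_
    obtain ⟨i, ρ, rfl⟩ := hne hρ
    exact and_congr_right fun _ => and_congr_left fun _ =>
      (cons_mem_posAnn _ _).trans (cons_mem_posAnn _ _).symm
  · refine (evSharp_func I a _ _).trans_le (le_trans ?_ (evSharp_func I a _ _).ge)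
    exact add_le_add_left (Nat.zero_le _) _
  · rcases f with f | f
    · intro _
      refine le_trans (le_of_eq ?_) (evSharp_func I a _ _).ge
      refine (congrArg₂ (· + ·) ?_ ((evSharp_func I a _ _).trans (zero_add _))).trans rfl
      refine (ev_func I a _ _).trans ?_
      have hf' : α.root = f := Subtype.ext hf.symm
      have hargs : ∀ i, asubst (emb (α.args i) : ATrm L D V) σ = emb (flat (ts i)) := fun i => by
        rw [asubst_emb]
        exact congrArg emb (congrFun hts i)
      rw [hf']
      exact congrArg (fun y => MvPolynomial.eval y _) (funext fun i => congrArg _ (hargs i))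
    · exact fun h => absurd h (nil_notMem_posAnn_inr f ts)

/-! ### Expected `#`-sums after a rewrite step -/

/-- What innermost and full rewrite steps with `α` have in common as far as `#`-sums are concerned.
Every entry `y.1` of the right-hand side is paired with the annotated instance `y.2` of `y.1.2` that
replaces the redex. The annotations of `y.1.2` itself count with the factor `c` (which is `1` for
steps at annotated positions), and the annotations inherited from proper subterms of the redex
contribute at most `rest`. -/
def PolInterp.StepBound (I : PolInterp L D) (a : V → ℕ) (α : ADP L D V) (ann : Prop)
    (s : ATrm L D V) (μ : Multiset (ℝ × ATrm L D V)) : Prop :=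
  ∃ (σ : V → Trm L V) (π : Position) (redex : ATrm L D V) (c rest : ℕ)
    (M : Multiset ((ℝ × ATrm L D V) × ATrm L D V)),
    M.map Prod.fst = α.rhs ∧ subtermAt s π = some redex ∧ flat redex = α.lhs.subst σ ∧
    (∀ y ∈ M, flat y.2 = flat (asubst y.1.2 σ)) ∧
    (∀ y ∈ M, I.evSharp a y.2 ≤ c * I.evSharp a (asubst y.1.2 σ) + rest) ∧
    c * I.ev a (asubst α.lhsSharp σ) + rest ≤ I.evSharp a redex ∧ (ann → c = 1) ∧
    μ = M.map (fun y => (y.1.1, if α.flag = true then replaceAt s π y.2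
      else disannoAbove π (replaceAt s π y.2)))

theorem mem_posAnn_iff_nil_mem {s t : ATrm L D V} {π : Position} (h : subtermAt s π = some t) :
    π ∈ posAnn s ↔ [] ∈ posAnn t := by
  simpa using mem_posAnn_iff_of_subtermAt h []

theorem FullStep.stepBound (I : PolInterp L D) (a : V → ℕ) {P : Set (ADP L D V)} {ann : Prop}
    {s : ATrm L D V} {μ : Multiset (ℝ × ATrm L D V)} (h : FullStep P ann s μ) :
    ∃ α ∈ P, I.StepBound a α ann s μ := by
  obtain ⟨α, hα, M, σ, π, redex, hM, hvrf, hsub, hflat, hann, hμ⟩ := h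
  obtain ⟨q, hq, hkept, hle, hle'⟩ := exists_redex_without_root I a hflat
  refine ⟨α, hα, ?_⟩
  rw [← mem_posAnn_iff_nil_mem hsub] at hle'
  by_cases hπ : π ∈ posAnn s
  · refine ⟨σ, π, redex, 1, I.evSharp a q, M.map fun y =>
      (y.1, anno (posAnn y.1.2 ∪ keptPos α.lhs y.2 redex) (asubst y.1.2 σ)), ?_, hsub, hflat,
      ?_, ?_, by simpa using hle' hπ, fun _ => rfl, ?_⟩
    · simpa using hM
    · intro z hz
      obtain ⟨y, hy, rfl⟩ := Multiset.mem_map.1 hz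
      exact flat_anno _ _
    · intro z hz
      obtain ⟨y, hy, rfl⟩ := Multiset.mem_map.1 hz
      rw [one_mul, hkept]
      exact evSharp_anno_union_keptPos_le I a (hvrf y hy) hq
    · rcases hμ with ⟨-, hf, rfl⟩ | ⟨-, hf, rfl⟩ | ⟨h, -⟩
      · simp [hf]
      · simp [hf]
      · exact absurd hπ h
  · refine ⟨σ, π, redex, 0, I.evSharp a q, M.map fun y =>
      (y.1, anno (keptPos α.lhs y.2 redex) (asubst y.1.2 σ)), ?_, hsub, hflat,
      ?_, ?_, by simpa using hle, fun h => absurd (hann.1 h) hπ, ?_⟩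
    · simpa using hM
    · intro z hz
      obtain ⟨y, hy, rfl⟩ := Multiset.mem_map.1 hz
      exact flat_anno _ _
    · intro z hz
      obtain ⟨y, hy, rfl⟩ := Multiset.mem_map.1 hz
      rw [zero_mul, zero_add, hkept]
      exact evSharp_anno_keptPos_le I a (hvrf y hy) hq
    · rcases hμ with ⟨h, -⟩ | ⟨h, -⟩ | ⟨-, hf, rfl⟩
      · exact absurd h hπ
      · exact absurd h hπ
      · simp [hf]

theorem InnermostStep.stepBound (I : PolInterp L D) (a : V → ℕ) {P : Set (ADP L D V)} {ann : Prop}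
    {s : ATrm L D V} {μ : Multiset (ℝ × ATrm L D V)} (h : InnermostStep P ann s μ) :
    ∃ α ∈ P, I.StepBound a α ann s μ := by
  obtain ⟨α, hα, σ, π, redex, hsub, hflat, -, hann, hμ⟩ := h
  obtain ⟨q, hq, -, hle, hle'⟩ := exists_redex_without_root I a hflat
  refine ⟨α, hα, ?_⟩
  rw [← mem_posAnn_iff_nil_mem hsub] at hle'
  by_cases hπ : π ∈ posAnn s
  · refine ⟨σ, π, redex, 1, 0, α.rhs.map fun x => (x, asubst x.2 σ), by simp, hsub, hflat,
      ?_, ?_, by have := hle' hπ; omega, fun _ => rfl, ?_⟩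
    · intro z hz
      obtain ⟨y, hy, rfl⟩ := Multiset.mem_map.1 hz
      rfl
    · intro z hz
      obtain ⟨y, hy, rfl⟩ := Multiset.mem_map.1 hz
      simp
    · rcases hμ with ⟨-, hf, rfl⟩ | ⟨-, hf, rfl⟩ | ⟨h, -⟩ | ⟨h, -⟩
      · simp [hf]
      · simp [hf]
      · exact absurd hπ h
      · exact absurd hπ h
  · refine ⟨σ, π, redex, 0, 0, α.rhs.map fun x => (x, emb ((flat x.2).subst σ)), by simp, hsub,
      hflat, ?_, ?_, by simp, fun h => absurd (hann.1 h) hπ, ?_⟩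
    · intro z hz
      obtain ⟨y, hy, rfl⟩ := Multiset.mem_map.1 hz
      rw [flat_emb, flat_asubst]
    · intro z hz
      obtain ⟨y, hy, rfl⟩ := Multiset.mem_map.1 hz
      simp [evSharp_emb]
    · rcases hμ with ⟨h, -⟩ | ⟨h, -⟩ | ⟨-, hf, rfl⟩ | ⟨-, hf, rfl⟩
      · exact absurd h hπ
      · exact absurd h hπ
      · simp [hf]
      · simp [hf]

theorem PolInterp.StepBound.map_fst {I : PolInterp L D} {a : V → ℕ} {α : ADP L D V} {ann : Prop}
    {s : ATrm L D V} {μ : Multiset (ℝ × ATrm L D V)} (h : I.StepBound a α ann s μ) :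
    μ.map Prod.fst = α.rhs.map Prod.fst := by
  obtain ⟨σ, π, redex, c, rest, M, hM, -, -, -, -, -, -, rfl⟩ := h
  rw [← hM]
  simp

theorem val_pol (I : PolInterp L D) (a : V → ℕ) (t : ATrm L D V) :
    val a (I.pol t) = I.ev a t := rfl

theorem val_sharpSum (I : PolInterp L D) (a : V → ℕ) (t : ATrm L D V) :
    val a (I.sharpSum t) = I.evSharp a t := rfl

/-- The value of `C[r]`, where `C` is the context of the redex. If the flag is `false`, then the
annotations above the redex vanish, so that its value no longer matters for the context. -/
theorem exists_context_bound {I : PolInterp L D} (hI : I.Multilinear) (a : V → ℕ)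
    {s redex : ATrm L D V} {π : Position} (h : subtermAt s π = some redex) (b : Bool) :
    ∃ A B : ℕ, (b = false → B = 0) ∧
      A + B * I.ev a (emb (flat redex)) + I.evSharp a redex ≤ I.evSharp a s ∧
      ∀ r, I.evSharp a (if b = true then replaceAt s π r else disannoAbove π (replaceAt s π r)) =
        A + B * I.ev a (emb (flat r)) + I.evSharp a r := by
  obtain ⟨A, A', B, hle, h₁, h₂⟩ := evSharp_replaceAt hI a s π redex h
  have hs := h₁ redex
  rw [replaceAt_self h] at hs
  cases b with
  | true => exact ⟨A, B, by simp, hs.ge, by simpa using h₁⟩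
  | false =>
    refine ⟨A', 0, by simp, ?_, by simpa using h₂⟩
    rw [hs]
    have := Nat.zero_le (B * I.ev a (emb (flat redex)))
    omega

/-- The `#`-sum does not increase in expectation. -/
theorem PolInterp.StepBound.expected_evSharp_le {I : PolInterp L D} (hI : I.Multilinear)
    {a : V → ℕ} {α : ADP L D V} {ann : Prop} {s : ATrm L D V} {μ : Multiset (ℝ × ATrm L D V)}
    (h : I.StepBound a α ann s μ)
    (h1 : ∀ a : V → ℕ, val a (I.pol α.lhsSharp) ≥ expVal a I.sharpSum α.rhs)
    (h3 : α.flag = true → ∀ a : V → ℕ,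
      val a (I.pol (emb α.lhs)) ≥ expVal a (fun r => I.pol (emb (flat r))) α.rhs) :
    (μ.map fun x => x.1 * (I.evSharp a x.2 : ℝ)).sum ≤ I.evSharp a s := by
  obtain ⟨σ, π, redex, c, rest, M, hM, hsub, hflat, hfM, hle, hred, -, rfl⟩ := h
  obtain ⟨A, B, hB, hs, hC⟩ := exists_context_bound hI a hsub α.flag
  set a' : V → ℕ := fun x => I.ev a (emb (σ x)) with ha'
  have hbound : ∀ y ∈ M, y.1.1 * (I.evSharp a (if α.flag = true then replaceAt s π y.2
      else disannoAbove π (replaceAt s π y.2)) : ℝ) ≤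
      y.1.1 * ((A : ℝ) + rest) + B * (y.1.1 * val a' (I.pol (emb (flat y.1.2)))) +
        c * (y.1.1 * val a' (I.sharpSum y.1.2)) := by
    intro y hy
    have hpos : 0 < y.1.1 := α.prob_pos _ (hM ▸ Multiset.mem_map_of_mem _ hy)
    have e₁ : I.ev a (emb (flat y.2)) = I.ev a' (emb (flat y.1.2)) := by
      rw [hfM y hy, ← asubst_emb_flat, ev_asubst]
    have e₂ := hle y hy
    rw [evSharp_asubst, ← ha'] at e₂
    rw [hC, e₁]
    have e₃ : (I.evSharp a y.2 : ℝ) ≤ c * val a' (I.sharpSum y.1.2) + rest := by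
      rw [val_sharpSum]
      exact_mod_cast e₂
    rw [val_pol]
    push_cast
    nlinarith
  rw [Multiset.map_map]
  refine (Multiset.sum_map_le_sum_map _ _ hbound).trans ?_
  rw [Multiset.sum_map_add, Multiset.sum_map_add, Multiset.sum_map_mul_left,
    Multiset.sum_map_mul_left, Multiset.sum_map_mul_right]
  have hp : (M.map fun y => y.1.1).sum = 1 := by
    rw [← α.prob_sum, ← hM, Multiset.map_map]
    rfl
  have hE : ∀ g : ATrm L D V → MvPolynomial V ℕ,
      (M.map fun y => y.1.1 * val a' (g y.1.2)).sum = expVal a' g α.rhs := by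
    intro g
    rw [expVal, ← hM, Multiset.map_map]
    rfl
  rw [hp, hE fun r => I.pol (emb (flat r)), hE]
  have hlhs : I.ev a (emb (flat redex)) = I.ev a' (emb α.lhs) := by
    rw [hflat, ← asubst_emb, ev_asubst]
  rw [ev_asubst, ← ha'] at hred
  have hs' : (A : ℝ) + B * val a' (I.pol (emb α.lhs)) + I.evSharp a redex ≤ I.evSharp a s := by
    rw [hlhs] at hs
    rw [val_pol]
    exact_mod_cast hs
  have hred' : c * val a' (I.pol α.lhsSharp) + rest ≤ (I.evSharp a redex : ℝ) := by
    rw [val_pol]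
    exact_mod_cast hred
  have hc : c * expVal a' I.sharpSum α.rhs ≤ c * val a' (I.pol α.lhsSharp) :=
    mul_le_mul_of_nonneg_left (h1 a') (Nat.cast_nonneg c)
  have hB' : B * expVal a' (fun r => I.pol (emb (flat r))) α.rhs ≤
      B * val a' (I.pol (emb α.lhs)) := by
    cases hf : α.flag with
    | true => exact mul_le_mul_of_nonneg_left (h3 hf a') (Nat.cast_nonneg B)
    | false => simp [hB hf]
  linarith

/-- A step at an annotated position with a strictly oriented ADP decreases the `#`-sum with the
probability of one of the entries of its right-hand side. -/
theorem PolInterp.StepBound.exists_evSharp_lt {I : PolInterp L D} (hI : I.Multilinear)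
    {a : V → ℕ} {α : ADP L D V} {ann : Prop} {s : ATrm L D V} {μ : Multiset (ℝ × ATrm L D V)}
    (h : I.StepBound a α ann s μ) (hann : ann)
    (h2 : ∃ x ∈ α.rhs,
      (∀ a : V → ℕ, val a (I.pol α.lhsSharp) > val a (I.sharpSum x.2)) ∧
      (α.flag = true → ∀ a : V → ℕ,
        val a (I.pol (emb α.lhs)) ≥ val a (I.pol (emb (flat x.2))))) :
    ∃ x ∈ μ, I.evSharp a x.2 < I.evSharp a s := by
  obtain ⟨σ, π, redex, c, rest, M, hM, hsub, hflat, hfM, hle, hred, hc, rfl⟩ := h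
  obtain ⟨A, B, hB, hs, hC⟩ := exists_context_bound hI a hsub α.flag
  obtain ⟨x, hx, hlt, hflag⟩ := h2
  obtain ⟨y, hy, rfl⟩ := Multiset.mem_map.1 (hM.symm ▸ hx)
  refine ⟨_, Multiset.mem_map_of_mem _ hy, ?_⟩
  simp only [hC]
  obtain rfl := hc hann
  set a' : V → ℕ := fun x => I.ev a (emb (σ x)) with ha'
  have e₁ : I.ev a (emb (flat y.2)) = I.ev a' (emb (flat y.1.2)) := by
    rw [hfM y hy, ← asubst_emb_flat, ev_asubst]
  have hlhs : I.ev a (emb (flat redex)) = I.ev a' (emb α.lhs) := by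
    rw [hflat, ← asubst_emb, ev_asubst]
  have e₂ := hle y hy
  rw [evSharp_asubst, ← ha'] at e₂
  rw [ev_asubst, ← ha'] at hred
  have e₃ : I.evSharp a' y.1.2 < I.ev a' α.lhsSharp := by
    have := hlt a'
    simp only [val_pol, val_sharpSum, gt_iff_lt, Nat.cast_lt] at this
    exact this
  have e₄ : B * I.ev a' (emb (flat y.1.2)) ≤ B * I.ev a' (emb α.lhs) := by
    cases hf : α.flag with
    | true =>
      refine Nat.mul_le_mul_left B ?_
      have := hflag hf a'
      simp only [val_pol, ge_iff_le, Nat.cast_le] at this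
      exact this
    | false => simp [hB hf]
  rw [hlhs] at hs
  rw [e₁]
  omega

/-! ### The tree structure of chain trees -/

section Trees

variable {Step : Prop → ATrm L D V → Multiset (ℝ × ATrm L D V) → Prop} {N : Type}
  (T : ChainTree Step N)

/-- The node `b` lies exactly `k` levels below the node `a`. -/
def ChainTree.Below : ℕ → N → N → Prop
  | 0, a, b => a = b
  | k + 1, a, b => ∃ c, ChainTree.Below k a c ∧ b ∈ T.children c

variable {T}

theorem ChainTree.Below.unique {k : ℕ} {a a' b : N} (h : T.Below k a b) (h' : T.Below k a' b) :
    a = a' := by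
  induction k generalizing b with
  | zero => exact Eq.trans h (Eq.symm h')
  | succ k ih =>
    obtain ⟨c, hc, hb⟩ := h
    obtain ⟨c', hc', hb'⟩ := h'
    obtain rfl := T.unique_parent _ _ _ hb hb'
    exact ih hc hc'

theorem ChainTree.below_add {j k : ℕ} {a c : N} :
    T.Below (j + k) a c ↔ ∃ b, T.Below j a b ∧ T.Below k b c := by
  induction k generalizing c with
  | zero => exact ⟨fun h => ⟨c, h, rfl⟩, by rintro ⟨b, h, rfl⟩; exact h⟩
  | succ k ih =>
    constructor
    · rintro ⟨d, hd, hc⟩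
      obtain ⟨b, hb, hbd⟩ := ih.1 hd
      exact ⟨b, hb, d, hbd, hc⟩
    · rintro ⟨b, hb, d, hbd, hc⟩
      exact ⟨d, ih.2 ⟨b, hb, hbd⟩, hc⟩

theorem ChainTree.below_one {a b : N} : T.Below 1 a b ↔ b ∈ T.children a :=
  ⟨by rintro ⟨c, rfl, h⟩; exact h, fun h => ⟨a, rfl, h⟩⟩

theorem ChainTree.exists_below_root (T : ChainTree Step N) (b : N) : ∃ k, T.Below k T.root b := by
  induction T.reachable b with
  | refl => exact ⟨0, rfl⟩
  | tail _ h ih =>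
    obtain ⟨k, hk⟩ := ih
    exact ⟨k + 1, _, hk, h⟩

theorem ChainTree.below_root_unique {j k : ℕ} {b : N} (hj : T.Below j T.root b)
    (hk : T.Below k T.root b) : j = k := by
  wlog hle : j ≤ k generalizing j k
  · exact (this hk hj (le_of_not_ge hle)).symm
  obtain ⟨i, rfl⟩ := Nat.exists_eq_add_of_le' hle
  obtain ⟨c, hc, hcb⟩ := ChainTree.below_add.1 hk
  obtain rfl := hj.unique hcb
  cases i with
  | zero => simp
  | succ i =>
    obtain ⟨d, -, hd⟩ := hc
    exact absurd hd (T.root_not_child d)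

/-- The distance of a node from the root. -/
noncomputable def ChainTree.depth (T : ChainTree Step N) (b : N) : ℕ :=
  (T.exists_below_root b).choose

theorem ChainTree.below_depth (T : ChainTree Step N) (b : N) : T.Below (T.depth b) T.root b :=
  (T.exists_below_root b).choose_spec

theorem ChainTree.Below.depth_eq {k : ℕ} {a b : N} (h : T.Below k a b) :
    T.depth b = T.depth a + k :=
  ChainTree.below_root_unique (T.below_depth b) (ChainTree.below_add.2 ⟨a, T.below_depth a, h⟩)

/-- The probabilities of the successors of an inner node add up to the probability of the node. -/
def ChainTree.Conservative (T : ChainTree Step N) : Prop :=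
  ∀ a, (T.children a).Nonempty → ∑ b ∈ T.children a, T.prob b = T.prob a

theorem ChainTree.conservative_of_step
    (hStep : ∀ ann s μ, Step ann s μ → (μ.map Prod.fst).sum = 1) (T : ChainTree Step N) :
    T.Conservative := by
  intro a ha
  have h := hStep _ _ _ (T.step a ha)
  rw [Multiset.map_map] at h
  have h' : ∑ b ∈ T.children a, T.prob b / T.prob a = 1 := h
  rw [← Finset.sum_div, div_eq_one_iff_eq (T.prob_pos a).ne'] at h'
  exact h'

theorem ChainTree.Conservative.prob_child_le (hT : T.Conservative) {a b : N}
    (h : b ∈ T.children a) : T.prob b ≤ T.prob a := by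
  rw [← hT a ⟨b, h⟩]
  exact Finset.single_le_sum (f := T.prob) (fun c _ => (T.prob_pos c).le) h

theorem ChainTree.Conservative.sum_weights (hT : T.Conservative) {a : N}
    (ha : (T.children a).Nonempty) : ∑ b ∈ T.children a, T.prob b / T.prob a = 1 := by
  rw [← Finset.sum_div, hT a ha, div_self (T.prob_pos a).ne']

theorem ChainTree.weight_nonneg (T : ChainTree Step N) (a b : N) : 0 ≤ T.prob b / T.prob a :=
  (div_pos (T.prob_pos b) (T.prob_pos a)).le

/-! ### The probability of non-termination -/

open Classical in
/-- The conditional probability, given that `a` is reached, of not having reached a leaf after `n`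
further steps. -/
noncomputable def ChainTree.survival (T : ChainTree Step N) : ℕ → N → ℝ
  | 0, a => if T.children a = ∅ then 0 else 1
  | n + 1, a => ∑ b ∈ T.children a, T.prob b / T.prob a * ChainTree.survival T n b

theorem ChainTree.survival_leaf {a : N} (ha : T.children a = ∅) (n : ℕ) : T.survival n a = 0 := by
  cases n <;> simp [ChainTree.survival, ha]

theorem ChainTree.survival_nonneg (T : ChainTree Step N) (n : ℕ) (a : N) :
    0 ≤ T.survival n a := by
  induction n generalizing a with
  | zero =>
    rw [ChainTree.survival]
    split <;> norm_num
  | succ n ih =>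
    exact Finset.sum_nonneg fun b _ => mul_nonneg (T.weight_nonneg a b) (ih b)

theorem ChainTree.Conservative.survival_le_one (hT : T.Conservative) (n : ℕ) (a : N) :
    T.survival n a ≤ 1 := by
  rcases (T.children a).eq_empty_or_nonempty with ha | ha
  · rw [ChainTree.survival_leaf ha]
    exact zero_le_one
  induction n generalizing a with
  | zero =>
    rw [ChainTree.survival]
    split <;> norm_num
  | succ n ih =>
    rw [ChainTree.survival, ← hT.sum_weights ha]
    refine Finset.sum_le_sum fun b _ => mul_le_of_le_one_right (T.weight_nonneg a b) ?_
    rcases (T.children b).eq_empty_or_nonempty with hb | hb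
    · rw [ChainTree.survival_leaf hb]
      exact zero_le_one
    · exact ih b hb

theorem ChainTree.Conservative.survival_antitone (hT : T.Conservative) (a : N) :
    Antitone fun n => T.survival n a := by
  refine antitone_nat_of_succ_le fun n => ?_
  induction n generalizing a with
  | zero =>
    rcases (T.children a).eq_empty_or_nonempty with ha | ha
    · rw [ChainTree.survival_leaf ha, ChainTree.survival_leaf ha]
    · rw [ChainTree.survival.eq_1 T a, if_neg ha.ne_empty]
      exact hT.survival_le_one 1 a
  | succ n ih =>
    exact Finset.sum_le_sum fun b _ => mul_le_mul_of_nonneg_left (ih b) (T.weight_nonneg a b)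

/-- The conditional probability, given that `a` is reached, of never reaching a leaf. -/
noncomputable def ChainTree.nonterm (T : ChainTree Step N) (a : N) : ℝ :=
  ⨅ n, T.survival n a

theorem ChainTree.Conservative.tendsto_survival (hT : T.Conservative) (a : N) :
    Tendsto (fun n => T.survival n a) atTop (𝓝 (T.nonterm a)) :=
  tendsto_atTop_ciInf (hT.survival_antitone a)
    ⟨0, by rintro _ ⟨n, rfl⟩; exact T.survival_nonneg n a⟩

theorem ChainTree.nonterm_nonneg (T : ChainTree Step N) (a : N) : 0 ≤ T.nonterm a :=
  le_ciInf fun n => T.survival_nonneg n a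

theorem ChainTree.nonterm_le_survival (T : ChainTree Step N) (n : ℕ) (a : N) :
    T.nonterm a ≤ T.survival n a :=
  ciInf_le ⟨0, by rintro _ ⟨n, rfl⟩; exact T.survival_nonneg n a⟩ n

theorem ChainTree.Conservative.nonterm_le_one (hT : T.Conservative) (a : N) : T.nonterm a ≤ 1 :=
  (T.nonterm_le_survival 0 a).trans (hT.survival_le_one 0 a)

theorem ChainTree.nonterm_leaf {a : N} (ha : T.children a = ∅) : T.nonterm a = 0 := by
  simp [ChainTree.nonterm, ChainTree.survival_leaf ha]

theorem ChainTree.Conservative.nonterm_eq_sum (hT : T.Conservative) (a : N) :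
    T.nonterm a = ∑ b ∈ T.children a, T.prob b / T.prob a * T.nonterm b :=
  tendsto_nhds_unique ((tendsto_add_atTop_iff_nat 1).2 (hT.tendsto_survival a))
    (tendsto_finsetSum _ fun b _ => (hT.tendsto_survival b).const_mul _)

/-- Maximum principle: a bounded subharmonic function that is nonpositive at the leaves is bounded
by the probability of non-termination. -/
theorem ChainTree.le_nonterm_of_subharmonic {d : N → ℝ} (hle : ∀ a, d a ≤ 1)
    (hleaf : ∀ a, T.children a = ∅ → d a ≤ 0)
    (hsub : ∀ a, (T.children a).Nonempty → d a ≤ ∑ b ∈ T.children a, T.prob b / T.prob a * d b)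
    (a : N) : d a ≤ T.nonterm a := by
  refine le_ciInf fun n => ?_
  induction n generalizing a with
  | zero =>
    rw [ChainTree.survival]
    split
    · next h => exact hleaf a h
    · exact hle a
  | succ n ih =>
    rcases (T.children a).eq_empty_or_nonempty with ha | ha
    · rw [ChainTree.survival_leaf ha]
      exact hleaf a ha
    · exact (hsub a ha).trans (Finset.sum_le_sum fun b _ =>
        mul_le_mul_of_nonneg_left (ih b) (T.weight_nonneg a b))

open Classical in
/-- The leaves at most `n` levels below the node `a`. -/
noncomputable def ChainTree.leavesWithin (T : ChainTree Step N) : ℕ → N → Finset N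
  | 0, a => if T.children a = ∅ then {a} else ∅
  | n + 1, a => if T.children a = ∅ then {a} else
      (T.children a).biUnion (ChainTree.leavesWithin T n)

theorem ChainTree.mem_leavesWithin {n : ℕ} {a x : N} :
    x ∈ T.leavesWithin n a ↔ T.children x = ∅ ∧ ∃ k ≤ n, T.Below k a x := by
  induction n generalizing a with
  | zero =>
    rw [ChainTree.leavesWithin]
    split
    · next h =>
      simp only [Finset.mem_singleton, nonpos_iff_eq_zero, exists_eq_left, ChainTree.Below]
      exact ⟨by rintro rfl; exact ⟨h, rfl⟩, fun h' => h'.2.symm⟩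
    · next h =>
      simp only [Finset.notMem_empty, nonpos_iff_eq_zero, exists_eq_left, ChainTree.Below,
        false_iff]
      rintro ⟨h', rfl⟩
      exact h h'
  | succ n ih =>
    have hsucc : ∀ {k}, T.Below (k + 1) a x ↔ ∃ b ∈ T.children a, T.Below k b x := by
      intro k
      rw [add_comm, ChainTree.below_add]
      exact exists_congr fun b => and_congr_left fun _ => ChainTree.below_one
    rw [ChainTree.leavesWithin]
    split
    · next h =>
      rw [Finset.mem_singleton]
      constructor
      · rintro rfl
        exact ⟨h, 0, Nat.zero_le _, rfl⟩
      · rintro ⟨-, k, -, hk⟩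
        cases k with
        | zero => exact hk.symm
        | succ k =>
          obtain ⟨b, hb, -⟩ := hsucc.1 hk
          simp [h] at hb
    · next h =>
      simp only [Finset.mem_biUnion, ih]
      constructor
      · rintro ⟨b, hb, hx, k, hk, hkx⟩
        exact ⟨hx, k + 1, by omega, hsucc.2 ⟨b, hb, hkx⟩⟩
      · rintro ⟨hx, k, hk, hkx⟩
        cases k with
        | zero =>
          obtain rfl : a = x := hkx
          exact absurd hx h
        | succ k =>
          obtain ⟨b, hb, hbx⟩ := hsucc.1 hkx
          exact ⟨b, hb, hx, k, by omega, hbx⟩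

theorem ChainTree.Conservative.sum_leavesWithin (hT : T.Conservative) (n : ℕ) (a : N) :
    ∑ x ∈ T.leavesWithin n a, T.prob x = T.prob a * (1 - T.survival n a) := by
  classical
  induction n generalizing a with
  | zero =>
    rw [ChainTree.leavesWithin, ChainTree.survival]
    split <;> simp
  | succ n ih =>
    rcases (T.children a).eq_empty_or_nonempty with ha | ha
    · simp [ChainTree.leavesWithin, ChainTree.survival_leaf ha, ha]
    · have hdisj : (T.children a : Set N).PairwiseDisjoint (T.leavesWithin n) := by
        intro b hb c hc hbc
        refine Finset.disjoint_left.2 fun x hx hx' => hbc ?_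
        obtain ⟨-, k, -, hk⟩ := ChainTree.mem_leavesWithin.1 hx
        obtain ⟨-, j, -, hj⟩ := ChainTree.mem_leavesWithin.1 hx'
        have h₁ := hk.depth_eq
        have h₂ := hj.depth_eq
        rw [(ChainTree.below_one.2 hb).depth_eq] at h₁
        rw [(ChainTree.below_one.2 hc).depth_eq] at h₂
        obtain rfl : k = j := by omega
        exact hk.unique hj
      rw [ChainTree.leavesWithin, if_neg ha.ne_empty]
      refine (Finset.sum_biUnion hdisj).trans ?_
      simp only [ih, ChainTree.survival, mul_sub, mul_one, Finset.sum_sub_distrib, hT a ha,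
        Finset.mul_sum]
      refine congrArg _ (Finset.sum_congr rfl fun b _ => ?_)
      rw [← mul_assoc, mul_div_cancel₀ _ (T.prob_pos a).ne']

theorem ChainTree.Conservative.leafProb_eq (hT : T.Conservative) :
    T.leafProb = ENNReal.ofReal (1 - T.nonterm T.root) := by
  classical
  have hn : ∀ n, ∑ x ∈ T.leavesWithin n T.root, ENNReal.ofReal (T.prob x) =
      ENNReal.ofReal (1 - T.survival n T.root) := by
    intro n
    rw [← ENNReal.ofReal_sum_of_nonneg fun x _ => (T.prob_pos x).le, hT.sum_leavesWithin,
      T.prob_root, one_mul]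
  apply le_antisymm
  · refine ENNReal.summable.tsum_le_of_sum_le fun s => ?_
    have hs : ∃ n, ∀ x ∈ s, x.1 ∈ T.leavesWithin n T.root := by
      refine ⟨s.sup fun x => T.depth x.1, fun x hx => ChainTree.mem_leavesWithin.2
        ⟨x.2, T.depth x.1, Finset.le_sup (f := fun x => T.depth x.1) hx, T.below_depth _⟩⟩
    obtain ⟨n, hsn⟩ := hs
    calc ∑ x ∈ s, ENNReal.ofReal (T.prob x.1)
        = ∑ x ∈ s.map (Function.Embedding.subtype _), ENNReal.ofReal (T.prob x) := by simp
      _ ≤ ∑ x ∈ T.leavesWithin n T.root, ENNReal.ofReal (T.prob x) := by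
          refine Finset.sum_le_sum_of_subset fun x hx => ?_
          obtain ⟨y, hy, rfl⟩ := Finset.mem_map.1 hx
          exact hsn y hy
      _ ≤ _ := by
          rw [hn]
          exact ENNReal.ofReal_le_ofReal (sub_le_sub_left (T.nonterm_le_survival n _) 1)
  · refine le_of_tendsto (ENNReal.tendsto_ofReal
      (tendsto_const_nhds.sub (hT.tendsto_survival T.root))) (Eventually.of_forall fun n => ?_)
    rw [← hn, ← Finset.sum_subtype_of_mem (p := fun x => T.children x = ∅)
      (fun x => ENNReal.ofReal (T.prob x)) (fun x hx => (ChainTree.mem_leavesWithin.1 hx).1)]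
    exact ENNReal.sum_le_tsum _

theorem ChainTree.Conservative.leafProb_eq_one_iff (hT : T.Conservative) :
    T.leafProb = 1 ↔ T.nonterm T.root = 0 := by
  rw [hT.leafProb_eq, ENNReal.ofReal_eq_one]
  constructor <;> intro h <;> linarith

end Trees

/-! ### Cutting chain trees -/

section Cut

variable {Step Step' : Prop → ATrm L D V → Multiset (ℝ × ATrm L D V) → Prop} {N : Type}

/-- The node `b` is reached from `r` without passing through a node of `S` before. -/
def ChainTree.CutReach (T : ChainTree Step N) (r : N) (S : Set N) (b : N) : Prop :=
  Relation.ReflTransGen (fun a c => a ∉ S ∧ c ∈ T.children a) r b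

variable {T : ChainTree Step N}

theorem ChainTree.CutReach.exists_below {r : N} {S : Set N} {b : N} (h : T.CutReach r S b) :
    ∃ k, T.Below k r b := by
  induction h with
  | refl => exact ⟨0, rfl⟩
  | tail _ h ih =>
    obtain ⟨k, hk⟩ := ih
    exact ⟨k + 1, _, hk, h.2⟩

theorem ChainTree.CutReach.prob_le (hT : T.Conservative) {r : N} {S : Set N} {b : N}
    (h : T.CutReach r S b) : T.prob b ≤ T.prob r := by
  induction h with
  | refl => exact le_rfl
  | tail _ h ih => exact (hT.prob_child_le h.2).trans ih

open Classical in
/-- The successors of a node in the tree below `r` that is cut at the nodes of `S`. -/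
noncomputable def ChainTree.cutChildren (T : ChainTree Step N) (r : N) (S : Set N)
    (a : {b // T.CutReach r S b}) : Finset {b // T.CutReach r S b} :=
  if a.1 ∈ S then ∅ else (T.children a.1).subtype (T.CutReach r S)

theorem ChainTree.mem_cutChildren {r : N} {S : Set N} {a b : {b // T.CutReach r S b}} :
    b ∈ T.cutChildren r S a ↔ a.1 ∉ S ∧ b.1 ∈ T.children a.1 := by
  unfold ChainTree.cutChildren
  split <;> simp_all

theorem ChainTree.cutChildren_map {r : N} {S : Set N} {a : {b // T.CutReach r S b}}
    (ha : a.1 ∉ S) :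
    (T.cutChildren r S a).map (Function.Embedding.subtype _) = T.children a.1 := by
  classical
  unfold ChainTree.cutChildren
  rw [if_neg ha]
  exact Finset.subtype_map_of_mem fun b hb => a.2.tail ⟨ha, hb⟩

theorem ChainTree.sum_cutChildren {r : N} {S : Set N} {a : {b // T.CutReach r S b}}
    (ha : a.1 ∉ S) (g : N → ℝ) :
    ∑ b ∈ T.cutChildren r S a, g b.1 = ∑ b ∈ T.children a.1, g b := by
  rw [← ChainTree.cutChildren_map ha, Finset.sum_map]
  rfl

theorem ChainTree.cutChildren_nonempty {r : N} {S : Set N} {a : {b // T.CutReach r S b}} :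
    (T.cutChildren r S a).Nonempty ↔ a.1 ∉ S ∧ (T.children a.1).Nonempty := by
  constructor
  · rintro ⟨b, hb⟩
    obtain ⟨h, h'⟩ := ChainTree.mem_cutChildren.1 hb
    exact ⟨h, b.1, h'⟩
  · rintro ⟨h, b, hb⟩
    exact ⟨⟨b, a.2.tail ⟨h, hb⟩⟩, ChainTree.mem_cutChildren.2 ⟨h, hb⟩⟩

/-- The tree below `r`, cut at the nodes of `S`, with conditional probabilities. It is a chain tree
for every step relation that comprises the steps at the remaining inner nodes. -/
noncomputable def ChainTree.cut (T : ChainTree Step N) (hT : T.Conservative) (r : N) (S : Set N)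
    (hS : ∀ a ∉ S, (T.children a).Nonempty → Step' (a ∈ T.A) (T.term a)
      ((T.children a).val.map (fun b => (T.prob b / T.prob a, T.term b)))) :
    ChainTree Step' {b // T.CutReach r S b} where
  root := ⟨r, .refl⟩
  children := T.cutChildren r S
  root_not_child := by
    intro a h
    obtain ⟨k, hk⟩ := a.2.exists_below
    have h' : T.Below (k + 1) r r := ⟨_, hk, (ChainTree.mem_cutChildren.1 h).2⟩
    have := h'.depth_eq
    omega
  unique_parent := fun a b c ha hb => Subtype.ext
    (T.unique_parent _ _ _ (ChainTree.mem_cutChildren.1 ha).2 (ChainTree.mem_cutChildren.1 hb).2)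
  reachable := by
    rintro ⟨a, ha⟩
    induction ha with
    | refl => exact .refl
    | tail h h' ih => exact ih.tail (ChainTree.mem_cutChildren.2 h')
  prob := fun a => T.prob a.1 / T.prob r
  term := fun a => T.term a.1
  prob_pos := fun a => div_pos (T.prob_pos _) (T.prob_pos _)
  prob_le_one := fun a => (div_le_one (T.prob_pos r)).2 (a.2.prob_le hT)
  prob_root := div_self (T.prob_pos r).ne'
  A := {a | a.1 ∉ S ∧ a.1 ∈ T.A}
  A_inner := fun a ha => ChainTree.cutChildren_nonempty.2 ⟨ha.1, T.A_inner _ ha.2⟩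
  step := by
    intro a ha
    obtain ⟨haS, hne⟩ := ChainTree.cutChildren_nonempty.1 ha
    have h := hS a.1 haS hne
    have hA : (a ∈ {a : {b // T.CutReach r S b} | a.1 ∉ S ∧ a.1 ∈ T.A}) = (a.1 ∈ T.A) :=
      propext ⟨fun h => h.2, fun h => ⟨haS, h⟩⟩
    rw [hA]
    rw [← ChainTree.cutChildren_map haS, Finset.map_val, Multiset.map_map] at h
    simp only [div_div_div_cancel_right₀ (T.prob_pos r).ne']
    exact h
  infinite_path := by
    intro path hpath i
    have h := fun i => ChainTree.mem_cutChildren.1 (hpath i)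
    obtain ⟨j, hij, hj⟩ := T.infinite_path (fun i => (path i).1) (fun i => (h i).2) i
    exact ⟨j, hij, (h j).1, hj⟩

theorem ChainTree.cut_conservative (hT : T.Conservative) (r : N) (S : Set N)
    (hS : ∀ a ∉ S, (T.children a).Nonempty → Step' (a ∈ T.A) (T.term a)
      ((T.children a).val.map (fun b => (T.prob b / T.prob a, T.term b)))) :
    (T.cut hT r S hS).Conservative := by
  intro a ha
  obtain ⟨haS, hne⟩ := ChainTree.cutChildren_nonempty.1 ha
  refine (ChainTree.sum_cutChildren haS fun b => T.prob b / T.prob r).trans ?_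
  rw [← Finset.sum_div, hT _ hne]
  rfl

/-- Maximum principle for a tree whose parts between nodes of `S` terminate almost surely: a
subharmonic function that is nonpositive at the leaves and on `S` is nonpositive everywhere. -/
theorem ChainTree.nonpos_of_subharmonic (hT : T.Conservative) (S : Set N)
    (hS : ∀ a ∉ S, (T.children a).Nonempty → Step' (a ∈ T.A) (T.term a)
      ((T.children a).val.map (fun b => (T.prob b / T.prob a, T.term b))))
    (hStep' : ∀ (M : Type) (T' : ChainTree Step' M), T'.leafProb = 1) {d : N → ℝ}
    (hle : ∀ a, d a ≤ 1) (hleaf : ∀ a, T.children a = ∅ → d a ≤ 0) (hdS : ∀ a ∈ S, d a ≤ 0)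
    (hsub : ∀ a ∉ S, (T.children a).Nonempty →
      d a ≤ ∑ b ∈ T.children a, T.prob b / T.prob a * d b) (r : N) : d r ≤ 0 := by
  have hroot := (T.cut_conservative hT r S hS).leafProb_eq_one_iff.1 (hStep' _ (T.cut hT r S hS))
  refine (ChainTree.le_nonterm_of_subharmonic (T := T.cut hT r S hS) (d := fun a => d a.1)
    (fun a => hle _) (fun a ha => ?_) (fun a ha => ?_) ⟨r, .refl⟩).trans hroot.le
  · by_cases haS : a.1 ∈ S
    · exact hdS _ haS
    · refine hleaf _ (Finset.not_nonempty_iff_eq_empty.1 fun hne => ?_)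
      exact (ChainTree.cutChildren_nonempty.2 ⟨haS, hne⟩).ne_empty ha
  · obtain ⟨haS, hne⟩ := ChainTree.cutChildren_nonempty.1 ha
    refine (hsub _ haS hne).trans (le_of_eq ?_)
    rw [← ChainTree.sum_cutChildren haS fun b => T.prob b / T.prob a.1 * d b]
    exact Finset.sum_congr rfl fun b _ => by
      simp only [ChainTree.cut, div_div_div_cancel_right₀ (T.prob_pos r).ne']

end Cut

/-! ### Ranking functions that decrease in expectation -/

/-- A supporting line of the convex function `2 ^ (-y)` on `ℕ` at `x`. Its slope is the right-hand
difference quotient, which leaves a gap at all smaller arguments. -/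
theorem half_pow_supporting_line (x y : ℕ) :
    (1 / 2 : ℝ) ^ x * (1 - ((y : ℝ) - x) / 2 + if y < x then 1 / 2 else 0) ≤ (1 / 2) ^ y := by
  split
  · next h =>
    obtain ⟨k, rfl⟩ := Nat.exists_eq_add_of_lt h
    have h₁ : 1 + ((k + 1 : ℕ) : ℝ) * 1 ≤ (1 + 1) ^ (k + 1) :=
      one_add_mul_le_pow (by norm_num) (k + 1)
    have h₂ : (1 / 2 : ℝ) ^ (y + k + 1) * (1 + 1) ^ (k + 1) = (1 / 2) ^ y := by
      rw [add_assoc, pow_add, mul_assoc, ← mul_pow]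
      norm_num
    rw [← h₂]
    refine mul_le_mul_of_nonneg_left (le_trans ?_ h₁) (by positivity)
    push_cast
    have : (0 : ℝ) ≤ k := Nat.cast_nonneg k
    linarith
  · next h =>
    obtain ⟨k, rfl⟩ := Nat.exists_eq_add_of_le (not_lt.1 h)
    have h₁ : 1 + (k : ℝ) * (-1 / 2) ≤ (1 + -1 / 2) ^ k :=
      one_add_mul_le_pow (by norm_num) k
    rw [pow_add]
    refine mul_le_mul_of_nonneg_left ?_ (by positivity)
    push_cast
    norm_num at h₁ ⊢
    linarith

/-- A bounded and strictly concave function of the rank: its expectation decreases in every step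
that decreases the rank with positive probability and does not increase its expectation. -/
noncomputable def potential (x : ℕ) : ℝ := 2 - (1 / 2) ^ x

theorem one_le_potential (x : ℕ) : 1 ≤ potential x := by
  have : (1 / 2 : ℝ) ^ x ≤ 1 := pow_le_one₀ (by norm_num) (by norm_num)
  unfold potential
  linarith

theorem potential_le_two (x : ℕ) : potential x ≤ 2 := by
  have : (0 : ℝ) ≤ (1 / 2 : ℝ) ^ x := by positivity
  unfold potential
  linarith

theorem sum_potential_le {ι : Type*} {s : Finset ι} {q : ι → ℝ} {y : ι → ℕ} {x : ℕ}
    (hq : ∀ i ∈ s, 0 ≤ q i) (hsum : ∑ i ∈ s, q i = 1) (hle : ∑ i ∈ s, q i * (y i : ℝ) ≤ x) :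
    ∑ i ∈ s, q i * potential (y i) ≤
      potential x - (1 / 2) ^ x / 2 * ∑ i ∈ s, if y i < x then q i else 0 := by
  have hpt : ∀ i ∈ s, q i * potential (y i) ≤ q i * (2 - (1 / 2) ^ x) +
      (1 / 2) ^ x / 2 * (q i * (y i : ℝ) - q i * x) - (1 / 2) ^ x / 2 *
        if y i < x then q i else 0 := by
    intro i hi
    have h := mul_le_mul_of_nonneg_left (half_pow_supporting_line x (y i)) (hq i hi)
    unfold potential
    split at h
    · next h' =>
      rw [if_pos h']
      linarith
    · next h' =>
      rw [if_neg h']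
      linarith
  refine (Finset.sum_le_sum hpt).trans ?_
  rw [Finset.sum_sub_distrib, Finset.sum_add_distrib, ← Finset.mul_sum, ← Finset.mul_sum,
    Finset.sum_sub_distrib, ← Finset.sum_mul, ← Finset.sum_mul, hsum]
  have : (0 : ℝ) ≤ (1 / 2) ^ x / 2 := by positivity
  have := mul_le_mul_of_nonneg_left hle this
  unfold potential
  linarith

section Ranking

variable {Step Step' : Prop → ATrm L D V → Multiset (ℝ × ATrm L D V) → Prop}

/-- If every step either belongs to the almost-surely terminating relation `Step'`, or decreases the
rank with at least the probability `ε`, and no step increases the rank in expectation, then almost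
every path is finite. -/
theorem leafProb_eq_one_of_rank {X : ATrm L D V → ℕ} {ε : ℝ} (hε : 0 < ε) (hε1 : ε ≤ 1)
    (hprob : ∀ ann s μ, Step ann s μ → (μ.map Prod.fst).sum = 1)
    (hrank : ∀ ann s μ, Step ann s μ → (μ.map fun x => x.1 * (X x.2 : ℝ)).sum ≤ X s)
    (hprogress : ∀ ann s μ, Step ann s μ → Step' ann s μ ∨ ∃ x ∈ μ, ε ≤ x.1 ∧ X x.2 < X s)
    (hStep' : ∀ (M : Type) (T' : ChainTree Step' M), T'.leafProb = 1)
    (N : Type) (T : ChainTree Step N) : T.leafProb = 1 := by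
  have hT : T.Conservative := T.conservative_of_step hprob
  rw [hT.leafProb_eq_one_iff]
  set x : N → ℕ := fun a => X (T.term a) with hx
  have hx_le : ∀ a, (T.children a).Nonempty →
      ∑ b ∈ T.children a, T.prob b / T.prob a * (x b : ℝ) ≤ x a := by
    intro a ha
    have h := hrank _ _ _ (T.step a ha)
    rw [Multiset.map_map] at h
    exact h
  have hgap : ∀ a, (T.children a).Nonempty →
      ∑ b ∈ T.children a, T.prob b / T.prob a * potential (x b) ≤ potential (x a) -
        (1 / 2) ^ x a / 2 * ∑ b ∈ T.children a, if x b < x a then T.prob b / T.prob a else 0 :=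
    fun a ha => sum_potential_le (fun b _ => T.weight_nonneg a b) (hT.sum_weights ha) (hx_le a ha)
  have hind_nonneg : ∀ a, ∀ b ∈ T.children a,
      (0 : ℝ) ≤ if x b < x a then T.prob b / T.prob a else 0 := by
    intro a b _
    split
    · exact T.weight_nonneg a b
    · exact le_rfl
  let S : Set N := {a | (T.children a).Nonempty ∧ ¬ Step' (a ∈ T.A) (T.term a)
    ((T.children a).val.map (fun b => (T.prob b / T.prob a, T.term b)))}
  have hS : ∀ a ∉ S, (T.children a).Nonempty → Step' (a ∈ T.A) (T.term a)
      ((T.children a).val.map (fun b => (T.prob b / T.prob a, T.term b))) :=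
    fun a ha hne => by_contra fun h => ha ⟨hne, h⟩
  have hprog : ∀ a ∈ S, ε ≤ ∑ b ∈ T.children a, if x b < x a then T.prob b / T.prob a else 0 := by
    rintro a ⟨hne, hnot⟩
    obtain ⟨z, hz, hεz, hlt⟩ := (hprogress _ _ _ (T.step a hne)).resolve_left hnot
    obtain ⟨b, hb, rfl⟩ := Multiset.mem_map.1 hz
    refine le_trans ?_ (Finset.single_le_sum (hind_nonneg a) hb)
    rw [if_pos hlt]
    exact hεz
  have hθlt : ∀ K : ℕ, 0 ≤ 1 - ε * (1 / 2 : ℝ) ^ K / 4 ∧ 1 - ε * (1 / 2 : ℝ) ^ K / 4 < 1 := by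
    intro K
    have h₁ : (1 / 2 : ℝ) ^ K ≤ 1 := pow_le_one₀ (by norm_num) (by norm_num)
    have h₂ : (0 : ℝ) < (1 / 2) ^ K := by positivity
    have h₃ := mul_le_mul hε1 h₁ h₂.le zero_le_one
    have h₄ := mul_pos hε h₂
    constructor <;> linarith
  -- Ranks above `K` are controlled by the term `x / K`. For ranks up to `K`, every visit of `S`
  -- decreases the expected potential by a fixed factor.
  have key : ∀ K : ℕ, 0 < K → ∀ m : ℕ, ∀ a, T.nonterm a ≤
      (x a : ℝ) / K + (1 - ε * (1 / 2) ^ K / 4) ^ m * potential (x a) := by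
    intro K hK m
    have hK' : (0 : ℝ) < K := Nat.cast_pos.2 hK
    induction m with
    | zero =>
      intro a
      rw [pow_zero, one_mul]
      have : (0 : ℝ) ≤ (x a : ℝ) / K := by positivity
      linarith [hT.nonterm_le_one a, one_le_potential (x a)]
    | succ m ih =>
      set θ : ℝ := 1 - ε * (1 / 2) ^ K / 4 with hθ
      have hθ0 : 0 ≤ θ := (hθlt K).1
      have hnonneg : ∀ n a, 0 ≤ (x a : ℝ) / K + θ ^ n * potential (x a) := fun n a => by
        have := one_le_potential (x a)
        positivity
      have hsum : ∀ n a, ∑ b ∈ T.children a, T.prob b / T.prob a *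
          ((x b : ℝ) / K + θ ^ n * potential (x b)) =
          (∑ b ∈ T.children a, T.prob b / T.prob a * (x b : ℝ)) / K +
            θ ^ n * ∑ b ∈ T.children a, T.prob b / T.prob a * potential (x b) := by
        intro n a
        rw [Finset.sum_div, Finset.mul_sum, ← Finset.sum_add_distrib]
        exact Finset.sum_congr rfl fun b _ => by ring
      intro a
      rw [← sub_nonpos]
      refine ChainTree.nonpos_of_subharmonic (d := fun a => T.nonterm a -
        ((x a : ℝ) / K + θ ^ (m + 1) * potential (x a))) hT S hS hStep' ?_ ?_ ?_ ?_ a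
      · intro a
        linarith [hT.nonterm_le_one a, hnonneg (m + 1) a]
      · intro a ha
        rw [ChainTree.nonterm_leaf ha]
        linarith [hnonneg (m + 1) a]
      · intro a ha
        rcases le_or_gt K (x a) with hxK | hxK
        · have h₁ : (1 : ℝ) ≤ x a / K := (one_le_div hK').2 (Nat.cast_le.2 hxK)
          have h₂ : 0 ≤ θ ^ (m + 1) * potential (x a) := by
            have := one_le_potential (x a)
            positivity
          linarith [hT.nonterm_le_one a]
        · have h₁ : T.nonterm a ≤ ∑ b ∈ T.children a, T.prob b / T.prob a *
              ((x b : ℝ) / K + θ ^ m * potential (x b)) := by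
            rw [hT.nonterm_eq_sum a]
            exact Finset.sum_le_sum fun b _ =>
              mul_le_mul_of_nonneg_left (ih b) (T.weight_nonneg a b)
          rw [hsum] at h₁
          have h₂ := div_le_div_of_nonneg_right (hx_le a ha.1) hK'.le
          have h₃ : ∑ b ∈ T.children a, T.prob b / T.prob a * potential (x b) ≤
              θ * potential (x a) := by
            have hpow : (1 / 2 : ℝ) ^ K ≤ (1 / 2) ^ x a :=
              pow_le_pow_of_le_one (by norm_num) (by norm_num) hxK.le
            have h₄ := mul_le_mul (div_le_div_of_nonneg_right hpow zero_le_two) (hprog a ha)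
              hε.le (by positivity)
            have h₅ : ε * (1 / 2) ^ K / 4 * potential (x a) ≤ ε * (1 / 2) ^ K / 4 * 2 :=
              mul_le_mul_of_nonneg_left (potential_le_two _) (by positivity)
            have h₆ := hgap a ha.1
            rw [hθ, sub_mul, one_mul]
            linarith
          have h₄ := mul_le_mul_of_nonneg_left h₃ (pow_nonneg hθ0 m)
          rw [← mul_assoc, ← pow_succ] at h₄
          linarith
      · intro a _ hne
        simp only [mul_sub, Finset.sum_sub_distrib]
        rw [← hT.nonterm_eq_sum a, hsum]
        have h₁ := div_le_div_of_nonneg_right (hx_le a hne) hK'.le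
        have h₂ : ∑ b ∈ T.children a, T.prob b / T.prob a * potential (x b) ≤ potential (x a) := by
          have := mul_nonneg (show (0 : ℝ) ≤ (1 / 2) ^ x a / 2 by positivity)
            (Finset.sum_nonneg (hind_nonneg a))
          linarith [hgap a hne]
        have h₃ := mul_le_mul_of_nonneg_left h₂ (pow_nonneg hθ0 (m + 1))
        linarith
  have hdiv : ∀ K : ℕ, 0 < K → T.nonterm T.root ≤ (x T.root : ℝ) / K := by
    intro K hK
    have hlim := ((tendsto_pow_atTop_nhds_zero_of_lt_one (hθlt K).1 (hθlt K).2).mul_const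
      (potential (x T.root))).const_add ((x T.root : ℝ) / K)
    rw [zero_mul, add_zero] at hlim
    exact ge_of_tendsto hlim (Eventually.of_forall fun m => key K hK m T.root)
  exact le_antisymm (ge_of_tendsto (tendsto_const_div_atTop_nhds_zero_nat _)
    ((eventually_gt_atTop 0).mono hdiv)) (T.nonterm_nonneg _)

end Ranking

/-! ### Terms with more annotations -/

/-- `ALe s t` says that `t` arises from `s` by annotating further symbols. -/
inductive ALe : ATrm L D V → ATrm L D V → Prop
  | var (x : V) : ALe (.var x) (.var x)
  | func {n : ℕ} (f : (annot L D).Functions n) (ts us : Fin n → ATrm L D V)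
      (h : ∀ i, ALe (ts i) (us i)) : ALe (.func f ts) (.func f us)
  | sharp {n : ℕ} (f : D n) (ts us : Fin n → ATrm L D V) (h : ∀ i, ALe (ts i) (us i)) :
      ALe (.func (Sum.inr f.1 : (annot L D).Functions n) ts)
        (.func (Sum.inl f : (annot L D).Functions n) us)

theorem ALe.refl (t : ATrm L D V) : ALe t t := by
  induction t with
  | var x => exact .var x
  | func f ts ih => exact .func f ts ts ih

theorem ALe.flat_eq {s t : ATrm L D V} (h : ALe s t) : flat s = flat t := by
  induction h with
  | var x => rfl
  | func f ts us h ih => exact congrArg (Term.func _) (funext ih)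
  | sharp f ts us h ih => exact congrArg (Term.func _) (funext ih)

theorem ALe.subtermAt {s t s' : ATrm L D V} (h : ALe s t) {π : Position}
    (hs : subtermAt s π = some s') : ∃ t', ADPFramework.subtermAt t π = some t' ∧ ALe s' t' := by
  induction π generalizing s t with
  | nil =>
    obtain rfl : s = s' := by simpa [ADPFramework.subtermAt] using hs
    exact ⟨t, by simp [ADPFramework.subtermAt], h⟩
  | cons i π ih =>
    cases h with
    | var x => simp [ADPFramework.subtermAt] at hs
    | func f ts us h =>
      simp only [ADPFramework.subtermAt] at hs ⊢
      split at hs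
      · next hi => simpa [hi] using ih (h _) hs
      · simp at hs
    | sharp f ts us h =>
      simp only [ADPFramework.subtermAt] at hs ⊢
      split at hs
      · next hi => simpa [hi] using ih (h _) hs
      · simp at hs

theorem ALe.posAnn_subset {s t : ATrm L D V} (h : ALe s t) : posAnn s ⊆ posAnn t := by
  rintro π ⟨n, f, ts, hs⟩
  obtain ⟨t', ht, hle⟩ := h.subtermAt hs
  cases hle with
  | func _ _ us _ => exact ⟨n, f, us, ht⟩

theorem ALe.replaceAt {s t r q : ATrm L D V} (h : ALe s t) (π : Position) (hr : ALe r q) :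
    ALe (replaceAt s π r) (replaceAt t π q) := by
  induction π generalizing s t with
  | nil => simpa [ADPFramework.replaceAt] using hr
  | cons i π ih =>
    cases h with
    | var x => exact .var x
    | func f ts us h =>
      refine .func f _ _ fun j => ?_
      split
      · exact ih (h j)
      · exact h j
    | sharp f ts us h =>
      refine .sharp f _ _ fun j => ?_
      split
      · exact ih (h j)
      · exact h j

theorem ALe.disannoAbove {s t : ATrm L D V} (h : ALe s t) (π : Position) :
    ALe (disannoAbove π s) (disannoAbove π t) := by
  induction π generalizing s t with
  | nil => simpa [ADPFramework.disannoAbove] using h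
  | cons i π ih =>
    cases h with
    | var x => exact .var x
    | func f ts us h =>
      refine .func _ _ _ fun j => ?_
      split
      · exact ih (h j)
      · exact h j
    | sharp f ts us h =>
      refine .func _ _ _ fun j => ?_
      split
      · exact ih (h j)
      · exact h j

theorem ALe.emb_flat (t : ATrm L D V) : ALe (emb (flat t)) t := by
  induction t with
  | var x => exact .var x
  | func f ts ih =>
    rcases f with f | f
    · exact .sharp f _ _ ih
    · exact .func _ _ _ ih

theorem ALe.asubst {r q : ATrm L D V} (h : ALe r q) (σ : V → Trm L V) :
    ALe (asubst r σ) (asubst q σ) := by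
  induction h with
  | var x => exact .refl _
  | func f ts us h ih => exact .func f _ _ ih
  | sharp f ts us h ih => exact .sharp f _ _ ih

theorem ALe.anno_mono (t : ATrm L D V) {Φ Φ' : Set Position} (hΦ : Φ ⊆ Φ') :
    ALe (anno Φ t) (anno Φ' t) := by
  induction t generalizing Φ Φ' with
  | var x => exact .var x
  | @func n f ts ih =>
    have hts : ∀ i : Fin n, ALe (anno {ρ | (i : ℕ) :: ρ ∈ Φ} (ts i))
        (anno {ρ | (i : ℕ) :: ρ ∈ Φ'} (ts i)) := fun i => ih i fun ρ hρ => hΦ hρ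
    by_cases h : [] ∈ Φ
    · rw [anno_func_of_mem h, anno_func_of_mem (hΦ h)]
      exact .func _ _ _ hts
    · by_cases h' : [] ∈ Φ'
      · rw [anno_func_of_notMem h, anno_func_of_mem h']
        by_cases hf : baseSym f ∈ D n
        · rw [show annSym f = Sum.inl ⟨baseSym f, hf⟩ from dif_pos hf]
          exact .sharp ⟨baseSym f, hf⟩ _ _ hts
        · rw [show annSym f = f from dif_neg hf]
          rcases f with f | f
          · exact absurd f.2 hf
          · exact .func _ _ _ hts
      · rw [anno_func_of_notMem h, anno_func_of_notMem h']
        exact .func _ _ _ hts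

theorem ALe.anno {s t : ATrm L D V} (h : flat s = flat t) {Φ Φ' : Set Position} (hΦ : Φ ⊆ Φ') :
    ALe (anno Φ s) (anno Φ' t) := by
  rw [← anno_emb_flat Φ s, h, anno_emb_flat]
  exact .anno_mono t hΦ

/-! ### Rewrite steps with more annotations -/

/-- Two multisets with the same image can be matched element by element. -/
theorem exists_matching {α β γ : Type*} {f : α → γ} {g : β → γ} {s : Multiset α} {t : Multiset β}
    (h : s.map f = t.map g) :
    ∃ R : Multiset (α × β), R.map Prod.fst = s ∧ R.map Prod.snd = t ∧
      ∀ z ∈ R, f z.1 = g z.2 := by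
  induction s using Multiset.induction generalizing t with
  | empty => exact ⟨0, rfl, (Multiset.map_eq_zero.1 h.symm).symm, by simp⟩
  | cons a s ih =>
    rw [Multiset.map_cons] at h
    obtain ⟨b, hb, hab⟩ := Multiset.mem_map.1 (h ▸ Multiset.mem_cons_self (f a) _)
    obtain ⟨t, rfl⟩ := Multiset.exists_cons_of_mem hb
    rw [Multiset.map_cons, hab, Multiset.cons_inj_right] at h
    obtain ⟨R, h₁, h₂, h₃⟩ := ih h
    exact ⟨(a, b) ::ₘ R, by simp [h₁], by simp [h₂], by
      simpa [hab] using h₃⟩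

/-- The ADP `β` arises from `α` by annotating further symbols of the right-hand side. -/
def ADP.ALe (α β : ADP L D V) : Prop :=
  α.lhs = β.lhs ∧ α.flag = β.flag ∧ ∃ Q : Multiset (ℝ × ATrm L D V × ATrm L D V),
    Q.map (fun y => (y.1, y.2.1)) = α.rhs ∧ Q.map (fun y => (y.1, y.2.2)) = β.rhs ∧
    ∀ y ∈ Q, ADPFramework.ALe y.2.1 y.2.2

theorem ADP.ALe.refl (α : ADP L D V) : α.ALe α :=
  ⟨rfl, rfl, α.rhs.map fun x => (x.1, x.2, x.2), by simp, by simp, by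
    intro y hy
    obtain ⟨x, -, rfl⟩ := Multiset.mem_map.1 hy
    exact .refl _⟩

theorem ADP.unannotate_ALe (α : ADP L D V) : α.unannotate.ALe α :=
  ⟨rfl, rfl, α.rhs.map fun x => (x.1, emb (flat x.2), x.2), by simp [ADP.unannotate], by simp, by
    intro y hy
    obtain ⟨x, -, rfl⟩ := Multiset.mem_map.1 hy
    exact .emb_flat _⟩

theorem ArgNormalForm.of_lhs {P P' : Set (ADP L D V)} (h : ∀ β ∈ P', ∃ γ ∈ P, γ.lhs = β.lhs)
    {t : Trm L V} (ht : ArgNormalForm P t) : ArgNormalForm P' t := by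
  rintro ⟨ρ, t', β, σ, hρ, hsub, hβ, hlhs⟩
  obtain ⟨γ, hγ, hγβ⟩ := h β hβ
  exact ht ⟨ρ, t', γ, σ, hρ, hsub, hγ, hγβ ▸ hlhs⟩

open Classical in
/-- The result of an innermost step at `π` that uses the right-hand side `r`. -/
noncomputable def innermostResult (b : Bool) (s : ATrm L D V) (π : Position) (σ : V → Trm L V)
    (r : ATrm L D V) : ATrm L D V :=
  let q := if π ∈ posAnn s then asubst r σ else emb ((flat r).subst σ)
  if b = true then replaceAt s π q else disannoAbove π (replaceAt s π q)

open Classical in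
/-- The result of a full step at `π` that uses the right-hand side `r`, if the annotations at the
positions of `Ψ` are inherited from the redex. -/
noncomputable def fullResult (b : Bool) (s : ATrm L D V) (π : Position) (σ : V → Trm L V)
    (r : ATrm L D V) (Ψ : Set Position) : ATrm L D V :=
  let q := if π ∈ posAnn s then anno (posAnn r ∪ Ψ) (asubst r σ) else anno Ψ (asubst r σ)
  if b = true then replaceAt s π q else disannoAbove π (replaceAt s π q)

theorem innermostStep_iff {P : Set (ADP L D V)} {ann : Prop} {s : ATrm L D V}
    {μ : Multiset (ℝ × ATrm L D V)} :
    InnermostStep P ann s μ ↔ ∃ α ∈ P, ∃ (σ : V → Trm L V) (π : Position) (redex : ATrm L D V),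
      subtermAt s π = some redex ∧ flat redex = α.lhs.subst σ ∧
      ArgNormalForm P (α.lhs.subst σ) ∧ (ann ↔ π ∈ posAnn s) ∧
      μ = α.rhs.map (fun x => (x.1, innermostResult α.flag s π σ x.2)) := by
  refine exists_congr fun α => and_congr_right fun _ => exists_congr fun σ => exists_congr fun π =>
    exists_congr fun redex => and_congr_right fun _ => and_congr_right fun _ =>
    and_congr_right fun _ => and_congr_right fun _ => ?_
  by_cases hπ : π ∈ posAnn s <;> cases hf : α.flag <;> simp [innermostResult, hπ]

theorem fullStep_iff {P : Set (ADP L D V)} {ann : Prop} {s : ATrm L D V}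
    {μ : Multiset (ℝ × ATrm L D V)} :
    FullStep P ann s μ ↔ ∃ α ∈ P,
      ∃ (M : Multiset ((ℝ × ATrm L D V) × (Position → Option Position)))
        (σ : V → Trm L V) (π : Position) (redex : ATrm L D V),
      M.map Prod.fst = α.rhs ∧ (∀ y ∈ M, IsVRF α.lhs y.1.2 y.2) ∧
      subtermAt s π = some redex ∧ flat redex = α.lhs.subst σ ∧ (ann ↔ π ∈ posAnn s) ∧
      (π ∈ posAnn s ∨ α.flag = true) ∧
      μ = M.map (fun y => (y.1.1,
        fullResult α.flag s π σ y.1.2 (keptPos α.lhs y.2 redex))) := by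
  refine exists_congr fun α => and_congr_right fun _ => exists_congr fun M => exists_congr fun σ =>
    exists_congr fun π => exists_congr fun redex => and_congr_right fun _ =>
    and_congr_right fun _ => and_congr_right fun _ => and_congr_right fun _ =>
    and_congr_right fun _ => ?_
  by_cases hπ : π ∈ posAnn s <;> cases hf : α.flag <;> simp [fullResult, hπ]

theorem ALe.innermostResult {s t r q : ATrm L D V} (h : ALe s t) (hr : ALe r q) (b : Bool)
    (π : Position) (σ : V → Trm L V) :
    ALe (innermostResult b s π σ r) (innermostResult b t π σ q) := by
  classical
  have key : ALe (if π ∈ posAnn s then ADPFramework.asubst r σ else emb ((flat r).subst σ))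
      (if π ∈ posAnn t then ADPFramework.asubst q σ else emb ((flat q).subst σ)) := by
    rw [hr.flat_eq]
    by_cases hπ : π ∈ posAnn s
    · rw [if_pos hπ, if_pos (h.posAnn_subset hπ)]
      exact hr.asubst σ
    · rw [if_neg hπ]
      split
      · rw [← flat_asubst]
        exact .emb_flat _
      · exact .refl _
  unfold ADPFramework.innermostResult
  cases b with
  | true => simpa using h.replaceAt π key
  | false => simpa using (h.replaceAt π key).disannoAbove π

theorem ALe.fullResult {s t r q : ATrm L D V} (h : ALe s t) (hr : ALe r q) (b : Bool)
    (π : Position) (σ : V → Trm L V) {Ψ Ψ' : Set Position} (hΨ : Ψ ⊆ Ψ') :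
    ALe (fullResult b s π σ r Ψ) (fullResult b t π σ q Ψ') := by
  classical
  have hflat : flat (ADPFramework.asubst r σ) = flat (ADPFramework.asubst q σ) :=
    (hr.asubst σ).flat_eq
  have key : ALe (if π ∈ posAnn s then ADPFramework.anno (posAnn r ∪ Ψ) (ADPFramework.asubst r σ)
        else ADPFramework.anno Ψ (ADPFramework.asubst r σ))
      (if π ∈ posAnn t then ADPFramework.anno (posAnn q ∪ Ψ') (ADPFramework.asubst q σ)
        else ADPFramework.anno Ψ' (ADPFramework.asubst q σ)) := by
    by_cases hπ : π ∈ posAnn s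
    · rw [if_pos hπ, if_pos (h.posAnn_subset hπ)]
      exact .anno hflat (Set.union_subset_union hr.posAnn_subset hΨ)
    · rw [if_neg hπ]
      split
      · exact .anno hflat (hΨ.trans Set.subset_union_right)
      · exact .anno hflat hΨ
  unfold ADPFramework.fullResult
  cases b with
  | true => simpa using h.replaceAt π key
  | false => simpa using (h.replaceAt π key).disannoAbove π

theorem keptPos_mono (ℓ : Trm L V) (φ : Position → Option Position) {s t : ATrm L D V}
    (h : ALe s t) : keptPos ℓ φ s ⊆ keptPos ℓ φ t := by
  rintro χ ⟨ρ, ρ', τ, x, h₁, h₂, h₃, h₄⟩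
  exact ⟨ρ, ρ', τ, x, h₁, h₂, h.posAnn_subset h₃, h₄⟩

/-- A step relation between annotated terms and multi-distributions lifts along additional
annotations to another step relation. -/
def StepLifts (Step Step' : Prop → ATrm L D V → Multiset (ℝ × ATrm L D V) → Prop) : Prop :=
  ∀ ann s μ t, Step ann s μ → ALe s t →
    ∃ (ann' : Prop) (M : Multiset (ℝ × ATrm L D V × ATrm L D V)), (ann → ann') ∧
      M.map (fun y => (y.1, y.2.1)) = μ ∧ Step' ann' t (M.map fun y => (y.1, y.2.2)) ∧
      ∀ y ∈ M, ALe y.2.1 y.2.2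

/-- Innermost steps lift from `P'` to `P` if every ADP of `P'` arises from one of `P` by removing
annotations; the second assumption ensures that arguments in normal form stay so. -/
theorem InnermostStep.lifts {P P' : Set (ADP L D V)} (h : ∀ α ∈ P', ∃ β ∈ P, α.ALe β)
    (hlhs : ∀ β ∈ P, ∃ γ ∈ P', γ.lhs = β.lhs) :
    StepLifts (InnermostStep P') (InnermostStep P) := by
  intro ann s μ t hstep hst
  obtain ⟨α, hα, σ, π, redex, hsub, hflat, hanf, hann, rfl⟩ := innermostStep_iff.1 hstep
  obtain ⟨β, hβ, hl, hf, Q, hQ, hQ', hle⟩ := h α hα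
  obtain ⟨redex', hsub', hredex⟩ := hst.subtermAt hsub
  rw [hl] at hflat hanf
  refine ⟨π ∈ posAnn t, Q.map fun y =>
    (y.1, innermostResult α.flag s π σ y.2.1, innermostResult β.flag t π σ y.2.2),
    fun h => hst.posAnn_subset (hann.1 h), ?_, innermostStep_iff.2 ⟨β, hβ, σ, π, redex', hsub',
      hredex.flat_eq ▸ hflat, hanf.of_lhs hlhs, Iff.rfl, ?_⟩, ?_⟩
  · rw [← hQ, Multiset.map_map, Multiset.map_map]
    rfl
  · rw [← hQ', Multiset.map_map, Multiset.map_map]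
    rfl
  · intro z hz
    obtain ⟨y, hy, rfl⟩ := Multiset.mem_map.1 hz
    rw [hf]
    exact hst.innermostResult (hle y hy) _ π σ

theorem FullStep.lifts {P P' : Set (ADP L D V)} (h : ∀ α ∈ P', ∃ β ∈ P, α.ALe β) :
    StepLifts (FullStep P') (FullStep P) := by
  intro ann s μ t hstep hst
  obtain ⟨α, hα, M, σ, π, redex, hM, hvrf, hsub, hflat, hann, hflag, rfl⟩ := fullStep_iff.1 hstep
  obtain ⟨β, hβ, hl, hf, Q, hQ, hQ', hle⟩ := h α hα
  obtain ⟨redex', hsub', hredex⟩ := hst.subtermAt hsub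
  obtain ⟨R, hR, hR', hmatch⟩ := exists_matching (hM.trans hQ.symm)
  have hmemM : ∀ z ∈ R, z.1 ∈ M := fun z hz => hR ▸ Multiset.mem_map_of_mem _ hz
  have hmemQ : ∀ z ∈ R, z.2 ∈ Q := fun z hz => hR' ▸ Multiset.mem_map_of_mem _ hz
  refine ⟨π ∈ posAnn t, R.map fun z =>
    (z.2.1, fullResult α.flag s π σ z.2.2.1 (keptPos α.lhs z.1.2 redex),
      fullResult β.flag t π σ z.2.2.2 (keptPos β.lhs z.1.2 redex')),
    fun h => hst.posAnn_subset (hann.1 h), ?_, fullStep_iff.2 ⟨β, hβ,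
      R.map fun z => ((z.2.1, z.2.2.2), z.1.2), σ, π, redex', ?_, ?_, hsub',
      by rw [← hredex.flat_eq, ← hl]; exact hflat, Iff.rfl, ?_, ?_⟩, ?_⟩
  · rw [← hR, Multiset.map_map, Multiset.map_map]
    refine Multiset.map_congr rfl fun z hz => ?_
    simp only [Function.comp_apply, hmatch z hz]
  · rw [← hQ', ← hR', Multiset.map_map, Multiset.map_map]
    rfl
  · intro y hy
    obtain ⟨z, hz, rfl⟩ := Multiset.mem_map.1 hy
    intro ρ ρ' x hρ hφ
    rw [← hl] at hρ
    have h₁ := hvrf _ (hmemM z hz) ρ ρ' x hρ hφ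
    rw [hmatch z hz] at h₁
    rw [← subtermAt_emb_flat_eq_var] at h₁ ⊢
    rw [← (hle _ (hmemQ z hz)).flat_eq]
    exact h₁
  · rw [← hf]
    exact hflag.imp_left fun h => hst.posAnn_subset h
  · rw [Multiset.map_map, Multiset.map_map]
    rfl
  · intro y hy
    obtain ⟨z, hz, rfl⟩ := Multiset.mem_map.1 hy
    rw [hf, hl]
    exact hst.fullResult (hle _ (hmemQ z hz)) _ π σ (keptPos_mono _ _ hredex)

/-! ### Rewrite steps at positions without annotation -/

/-- A step with `α` can be repeated with every problem that has no new left-hand sides and contains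
`α` or, if the position is not annotated, `♭(α)`. -/
theorem InnermostStep.exists_adp {P : Set (ADP L D V)} {ann : Prop} {s : ATrm L D V}
    {μ : Multiset (ℝ × ATrm L D V)} (h : InnermostStep P ann s μ) :
    ∃ α ∈ P, ∀ P' : Set (ADP L D V), (∀ β ∈ P', ∃ γ ∈ P, γ.lhs = β.lhs) →
      (α ∈ P' → InnermostStep P' ann s μ) ∧
      (α.unannotate ∈ P' → ¬ ann → InnermostStep P' ann s μ) := by
  obtain ⟨α, hα, σ, π, redex, hsub, hflat, hanf, hann, hμ⟩ := innermostStep_iff.1 h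
  refine ⟨α, hα, fun P' hP' => ⟨fun hα' => innermostStep_iff.2 ⟨α, hα', σ, π, redex, hsub, hflat,
    hanf.of_lhs hP', hann, hμ⟩, fun hα' hnot => innermostStep_iff.2 ⟨α.unannotate, hα', σ, π, redex,
    hsub, hflat, hanf.of_lhs hP', hann, ?_⟩⟩⟩
  rw [hμ, ADP.unannotate, Multiset.map_map]
  refine Multiset.map_congr rfl fun x _ => ?_
  simp [innermostResult, mt hann.2 hnot, flat_emb]

/-- A step with `α` can be repeated with every problem that contains `α` or, if the position is not
annotated, `♭(α)`. -/
theorem FullStep.exists_adp {P : Set (ADP L D V)} {ann : Prop} {s : ATrm L D V}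
    {μ : Multiset (ℝ × ATrm L D V)} (h : FullStep P ann s μ) :
    ∃ α ∈ P, ∀ P' : Set (ADP L D V),
      (α ∈ P' → FullStep P' ann s μ) ∧ (α.unannotate ∈ P' → ¬ ann → FullStep P' ann s μ) := by
  obtain ⟨α, hα, M, σ, π, redex, hM, hvrf, hsub, hflat, hann, hflag, hμ⟩ := fullStep_iff.1 h
  refine ⟨α, hα, fun P' => ⟨fun hα' => fullStep_iff.2 ⟨α, hα', M, σ, π, redex, hM, hvrf, hsub,
    hflat, hann, hflag, hμ⟩, fun hα' hnot => fullStep_iff.2 ⟨α.unannotate, hα',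
    M.map fun y => ((y.1.1, emb (flat y.1.2)), y.2), σ, π, redex, ?_, ?_, hsub, hflat, hann, hflag,
    ?_⟩⟩⟩
  · rw [show α.unannotate.rhs = α.rhs.map fun x => (x.1, emb (flat x.2)) from rfl, ← hM,
      Multiset.map_map, Multiset.map_map]
    rfl
  · intro z hz
    obtain ⟨y, hy, rfl⟩ := Multiset.mem_map.1 hz
    intro ρ ρ' x hρ hφ
    exact subtermAt_emb_flat_eq_var.2 (hvrf y hy ρ ρ' x hρ hφ)
  · rw [hμ, Multiset.map_map]
    refine Multiset.map_congr rfl fun y _ => ?_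
    simp only [fullResult, mt hann.2 hnot, if_false, Function.comp_apply, asubst_emb_flat,
      anno_emb_flat]
    rfl

/-! ### Relabelling chain trees -/

/-- A chain tree can be relabelled along a lifting of its steps, without changing its shape. -/
theorem ChainTree.exists_leafProb_eq_of_stepLifts
    {Step Step' : Prop → ATrm L D V → Multiset (ℝ × ATrm L D V) → Prop}
    (hlift : StepLifts Step Step') {N : Type} (T : ChainTree Step N) :
    ∃ T' : ChainTree Step' N, T'.leafProb = T.leafProb := by
  classical
  have hnode : ∀ a t, (T.children a).Nonempty → ALe (T.term a) t → ∃ f : N → ATrm L D V,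
      (∀ b ∈ T.children a, ALe (T.term b) (f b)) ∧ ∃ ann' : Prop, (a ∈ T.A → ann') ∧
        Step' ann' t ((T.children a).val.map fun b => (T.prob b / T.prob a, f b)) := by
    intro a t ha ht
    obtain ⟨ann', M, hann, hM, hstep, hle⟩ := hlift _ _ _ t (T.step a ha) ht
    obtain ⟨R, hR, hR', hmatch⟩ := exists_matching hM.symm
    -- Since the successors are pairwise distinct, the matching is the graph of a function.
    have hinj : ∀ z ∈ R, ∀ z' ∈ R, z.1 = z'.1 → z = z' := fun z hz z' hz' h =>
      Multiset.inj_on_of_nodup_map (f := Prod.fst) (hR ▸ (T.children a).nodup) z hz z' hz' h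
    have hex : ∀ b, ∃ t', ∀ z ∈ R, z.1 = b → z.2.2.2 = t' := by
      intro b
      by_cases hb : ∃ z ∈ R, z.1 = b
      · obtain ⟨z, hz, rfl⟩ := hb
        exact ⟨z.2.2.2, fun z' hz' h => by rw [hinj z' hz' z hz h]⟩
      · exact ⟨T.term b, fun z hz h => absurd ⟨z, hz, h⟩ hb⟩
    choose f hf using hex
    refine ⟨f, fun b hb => ?_, ann', hann, ?_⟩
    · have hb' : b ∈ R.map Prod.fst := hR ▸ hb
      obtain ⟨z, hz, rfl⟩ := Multiset.mem_map.1 hb'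
      have h := hle _ (hR' ▸ Multiset.mem_map_of_mem Prod.snd hz)
      rw [hf _ z hz rfl] at h
      have h' := congrArg Prod.snd (hmatch z hz)
      simp only at h'
      rwa [h']
    · have : (T.children a).val.map (fun b => (T.prob b / T.prob a, f b)) =
          M.map fun y => (y.1, y.2.2) := by
        rw [← hR, ← hR', Multiset.map_map, Multiset.map_map]
        refine Multiset.map_congr rfl fun z hz => ?_
        simp only [Function.comp_apply, ← hf _ z hz rfl]
        rw [show T.prob z.1 / T.prob a = z.2.1 from congrArg Prod.fst (hmatch z hz)]
      rwa [this]
  have : Nonempty (ATrm L D V) := ⟨T.term T.root⟩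
  choose! pick hpick using hnode
  -- The new labels are defined by recursion on the depth; the value of `tmN n` matters only at
  -- nodes of depth `n`.
  let tmN : ℕ → N → ATrm L D V := fun n => Nat.rec T.term
    (fun _ g b => if h : ∃ a, b ∈ T.children a then pick h.choose (g h.choose) b else T.term b) n
  let tm : N → ATrm L D V := fun b => tmN (T.depth b) b
  have hroot : tm T.root = T.term T.root := by
    have h : T.depth T.root = 0 :=
      ChainTree.below_root_unique (T.below_depth T.root) (show T.Below 0 _ _ from rfl)
    simp only [tm, h]
    rfl
  have hchild : ∀ a, ∀ b ∈ T.children a, tm b = pick a (tm a) b := by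
    intro a b hb
    have h : ∃ a, b ∈ T.children a := ⟨a, hb⟩
    have ha : h.choose = a := T.unique_parent _ _ _ h.choose_spec hb
    have hd : T.depth b = T.depth a + 1 := (ChainTree.below_one.2 hb).depth_eq
    have : tm b = pick h.choose (tmN (T.depth a) h.choose) b := by
      simp only [tm, hd]
      exact dif_pos h
    rw [this, ha]
  have hle : ∀ b, ALe (T.term b) (tm b) := by
    intro b
    induction T.reachable b with
    | refl =>
      rw [hroot]
      exact .refl _
    | @tail a b _ hb ih =>
      rw [hchild a b hb]
      exact (hpick a _ ⟨b, hb⟩ ih).1 b hb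
  have hstep : ∀ a, (T.children a).Nonempty → ∃ ann' : Prop, (a ∈ T.A → ann') ∧
      Step' ann' (tm a) ((T.children a).val.map fun b => (T.prob b / T.prob a, tm b)) := by
    intro a ha
    obtain ⟨-, ann', h, h'⟩ := hpick a _ ha (hle a)
    refine ⟨ann', h, ?_⟩
    rwa [Multiset.map_congr rfl fun b hb => by rw [hchild a b hb]]
  -- A position that is not annotated in the old label may be annotated in the new one, so the set
  -- of nodes with steps at annotated positions may grow.
  let A' : Set N := {a | (T.children a).Nonempty ∧ ((a ∈ T.A) ∨
    Step' True (tm a) ((T.children a).val.map fun b => (T.prob b / T.prob a, tm b)))}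
  refine ⟨{ root := T.root, children := T.children, root_not_child := T.root_not_child,
            unique_parent := T.unique_parent, reachable := T.reachable, prob := T.prob,
            term := tm, prob_pos := T.prob_pos, prob_le_one := T.prob_le_one,
            prob_root := T.prob_root, A := A', A_inner := fun a ha => ha.1,
            step := fun a ha => ?_,
            infinite_path := fun path hpath i => ?_ }, rfl⟩
  · obtain ⟨ann', h, h'⟩ := hstep a ha
    by_cases hann : ann'
    · rw [eq_true hann] at h'
      rwa [eq_true (show a ∈ A' from ⟨ha, .inr h'⟩)]
    · rw [eq_false hann] at h'
      by_cases hA : a ∈ A'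
      · rw [eq_true hA]
        exact hA.2.resolve_left fun h'' => hann (h h'')
      · rwa [eq_false hA]
  · obtain ⟨j, hij, hj⟩ := T.infinite_path path hpath i
    exact ⟨j, hij, T.A_inner _ hj, .inl hj⟩

/-! ### The reduction pair processor -/

/-- Since `P` is finite, the probabilities in its right-hand sides are bounded away from `0`. -/
theorem exists_pos_le_prob {P : Set (ADP L D V)} (hfin : P.Finite) :
    ∃ ε : ℝ, 0 < ε ∧ ε ≤ 1 ∧ ∀ α ∈ P, ∀ x ∈ α.rhs, ε ≤ x.1 := by
  classical
  let F : Finset ℝ := insert 1 (hfin.toFinset.biUnion fun α => (α.rhs.map Prod.fst).toFinset)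
  have hF : ∀ p ∈ F, 0 < p := by
    intro p hp
    simp only [F, Finset.mem_insert, Finset.mem_biUnion, Multiset.mem_toFinset,
      Multiset.mem_map] at hp
    rcases hp with rfl | ⟨α, -, x, hx, rfl⟩
    · exact one_pos
    · exact α.prob_pos x hx
  have hne : F.Nonempty := Finset.insert_nonempty _ _
  refine ⟨F.min' hne, hF _ (F.min'_mem hne), F.min'_le _ (Finset.mem_insert_self _ _),
    fun α hα x hx => F.min'_le _ (Finset.mem_insert_of_mem (Finset.mem_biUnion.2
      ⟨α, hfin.mem_toFinset.2 hα, Multiset.mem_toFinset.2 (Multiset.mem_map_of_mem _ hx)⟩))⟩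

/-- Almost-sure termination passes from the processed problem `P'` to `P`, for any kind of rewrite
steps whose `#`-sums are bounded as in `PolInterp.StepBound` and for which all steps that are not
strictly decreasing are possible with `P'`. -/
theorem leafProb_eq_one_of_stepBound {I : PolInterp L D} (hI : I.Multilinear)
    {P Pgt : Set (ADP L D V)} (hfin : P.Finite)
    (h1 : ∀ α ∈ P, ∀ a : V → ℕ, val a (I.pol α.lhsSharp) ≥ expVal a I.sharpSum α.rhs)
    (h2 : ∀ α ∈ Pgt, ∃ x ∈ α.rhs,
      (∀ a : V → ℕ, val a (I.pol α.lhsSharp) > val a (I.sharpSum x.2)) ∧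
      (α.flag = true → ∀ a : V → ℕ,
        val a (I.pol (emb α.lhs)) ≥ val a (I.pol (emb (flat x.2)))))
    (h3 : ∀ α ∈ P, α.flag = true → ∀ a : V → ℕ,
      val a (I.pol (emb α.lhs)) ≥ expVal a (fun r => I.pol (emb (flat r))) α.rhs)
    {Step Step' : Prop → ATrm L D V → Multiset (ℝ × ATrm L D V) → Prop}
    (hbound : ∀ ann s μ, Step ann s μ → ∃ α ∈ P, I.StepBound 0 α ann s μ ∧
      (Step' ann s μ ∨ ann ∧ α ∈ Pgt))
    (hStep' : ∀ (M : Type) (T' : ChainTree Step' M), T'.leafProb = 1)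
    (N : Type) (T : ChainTree Step N) : T.leafProb = 1 := by
  obtain ⟨ε, hε, hε1, hεle⟩ := exists_pos_le_prob hfin
  refine leafProb_eq_one_of_rank (X := I.evSharp 0) hε hε1 ?_ ?_ ?_ hStep' N T
  · intro ann s μ h
    obtain ⟨α, -, hb, -⟩ := hbound ann s μ h
    rw [hb.map_fst, α.prob_sum]
  · intro ann s μ h
    obtain ⟨α, hα, hb, -⟩ := hbound ann s μ h
    exact hb.expected_evSharp_le hI (h1 α hα) (h3 α hα)
  · intro ann s μ h
    obtain ⟨α, hα, hb, h' | ⟨hann, hgt⟩⟩ := hbound ann s μ h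
    · exact .inl h'
    · obtain ⟨x, hx, hlt⟩ := hb.exists_evSharp_lt hI hann (h2 α hgt)
      obtain ⟨z, hz, hzx⟩ := Multiset.mem_map.1 (hb.map_fst ▸ Multiset.mem_map_of_mem Prod.fst hx)
      exact .inr ⟨x, hx, hzx ▸ hεle α hα z hz, hlt⟩

end ADPFramework

open ADPFramework
theorem mainTheorem3 {L : FirstOrder.Language.{u, w}}
    {D : ∀ n, Set (L.Functions n)} {V : Type v}
    (I : PolInterp L D) (hI : I.Multilinear)
    (P Pge Pgt : Set (ADP L D V)) (hfin : P.Finite)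
    (hP : P = Pge ∪ Pgt) (hdisj : Disjoint Pge Pgt) (hne : Pgt.Nonempty)
    (h1 : ∀ α ∈ P, ∀ a : V → ℕ, val a (I.pol α.lhsSharp) ≥ expVal a I.sharpSum α.rhs)
    (h2 : ∀ α ∈ Pgt, ∃ x ∈ α.rhs,
      (∀ a : V → ℕ, val a (I.pol α.lhsSharp) > val a (I.sharpSum x.2)) ∧
      (α.flag = true → ∀ a : V → ℕ,
        val a (I.pol (emb α.lhs)) ≥ val a (I.pol (emb (flat x.2)))))
    (h3 : ∀ α ∈ P, α.flag = true → ∀ a : V → ℕ,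
      val a (I.pol (emb α.lhs)) ≥ expVal a (fun r => I.pol (emb (flat r))) α.rhs) :
    (SoundFor IAST P {Pge ∪ ADP.unannotate '' Pgt} ∧
      CompleteFor IAST P {Pge ∪ ADP.unannotate '' Pgt}) ∧
    (SoundFor AST P {Pge ∪ ADP.unannotate '' Pgt} ∧
      CompleteFor AST P {Pge ∪ ADP.unannotate '' Pgt}) := by
  set P' : Set (ADP L D V) := Pge ∪ ADP.unannotate '' Pgt with hP'
  have hle : ∀ α ∈ P', ∃ β ∈ P, α.ALe β := by
    rintro _ (hα | ⟨α, hα, rfl⟩)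
    · exact ⟨_, hP ▸ .inl hα, .refl _⟩
    · exact ⟨α, hP ▸ .inr hα, α.unannotate_ALe⟩
  have hlhs : ∀ β ∈ P, ∃ γ ∈ P', γ.lhs = β.lhs := by
    intro β hβ
    rcases hP ▸ hβ with hβ | hβ
    · exact ⟨β, .inl hβ, rfl⟩
    · exact ⟨β.unannotate, .inr ⟨β, hβ, rfl⟩, rfl⟩
  have hlhs' : ∀ α ∈ P', ∃ β ∈ P, β.lhs = α.lhs := fun α hα =>
    let ⟨β, hβ, h⟩ := hle α hα
    ⟨β, hβ, h.1.symm⟩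
  -- A step with `α` is also possible with `P'`, unless `α ∈ Pgt` and the position is annotated: at
  -- other positions the annotations of the right-hand side are not used.
  have hcases : ∀ {ann Q : Prop} {α : ADP L D V}, α ∈ P → (α ∈ P' → Q) ∧
      (α.unannotate ∈ P' → ¬ ann → Q) → Q ∨ ann ∧ α ∈ Pgt := by
    intro ann Q α hα ⟨hq, hq'⟩
    rcases hP ▸ hα with hα | hα
    · exact .inl (hq (.inl hα))
    · by_cases hann : ann
      · exact .inr ⟨hann, hα⟩
      · exact .inl (hq' (.inr ⟨α, hα, rfl⟩) hann)
  refine ⟨⟨fun h => ?_, fun h => ?_⟩, ⟨fun h => ?_, fun h => ?_⟩⟩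
  · refine leafProb_eq_one_of_stepBound hI hfin h1 h2 h3 (fun ann s μ hs => ?_) (h P' rfl)
    obtain ⟨α, hα, hstep⟩ := hs.exists_adp
    have hself : ∀ β ∈ ({α} : Set (ADP L D V)), ∃ γ ∈ P, γ.lhs = β.lhs := by
      rintro _ rfl
      exact ⟨_, hα, rfl⟩
    -- The bound is needed for the same ADP, hence the restriction of the problem to `{α}`.
    obtain ⟨_, rfl, hb⟩ := ((hstep {α} hself).1 rfl).stepBound I 0
    exact ⟨_, hα, hb, hcases hα (hstep P' hlhs')⟩
  · rintro _ rfl N T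
    obtain ⟨T', hT'⟩ := T.exists_leafProb_eq_of_stepLifts (InnermostStep.lifts hle hlhs)
    exact hT' ▸ h N T'
  · refine leafProb_eq_one_of_stepBound hI hfin h1 h2 h3 (fun ann s μ hs => ?_) (h P' rfl)
    obtain ⟨α, hα, hstep⟩ := hs.exists_adp
    obtain ⟨_, rfl, hb⟩ := ((hstep {α}).1 rfl).stepBound I 0
    exact ⟨_, hα, hb, hcases hα (hstep P')⟩
  · rintro _ rfl N T
    obtain ⟨T', hT'⟩ := T.exists_leafProb_eq_of_stepLifts (FullStep.lifts hle)
    exact hT' ▸ h N T'
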